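/- Let $(\mathscr{C},\mathbb{E},\mathfrak{s})$ be an extriangulated category and let $\widetilde{\mathscr{C}}$ be its idempotent completion: objects are pairs $(A,e)$ with $e\colon A\to A$ idempotent in $\mathscr{C}$, and morphisms $(A,e)\to(B,e')$ are morphisms $\alpha\colon A\to B$ with $\alpha e=e'\alpha=\alpha$. Let $\iota\colon\mathscr{C}\to\widetilde{\mathscr{C}}$, $A\mapsto(A,\mathrm{id}_A)$, be the canonical functor. Define $\mathbb{F}((C,f),(A,e))=\{\omega\in\mathbb{E}(C,A)\mid f^{*}\omega=\omega=e_{*}\omega\}$, with the functoriality induced from $\mathbb{E}$. For $\omega\in\mathbb{F}((C,f),(A,e))$ let $\mathfrak{c}(\omega)$ be the equivalence class of the sequence $$(A,e)\xrightarrow{\;b\alpha\;}(M,b)\xrightarrow{\;\beta b\;}(C,f),$$ where $A\xrightarrow{\alpha}M\xrightarrow{\beta}C$ realizes $\omega$ in $\mathscr{C}$ and $b\colon M\to M$ is an idempotent with $b\alpha=\alpha e$ and $\beta b=f\beta$. Call an additive functor between extriangulated categories exact if it sends conflations to conflations. Then: 1. $(\widetilde{\mathscr{C}},\mathbb{F},\mathfrak{c})$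 is an extriangulated category (in particular, $\mathfrak c$ is well defined), and $\iota$ is exact for this structure. 2. This is the smallest extriangulated structure on $\widetilde{\mathscr{C}}$ for which $\iota$ is exact: every conflation of $(\widetilde{\mathscr{C}},\mathbb{F},\mathfrak{c})$ is a conflation of every extriangulated structure on $\widetilde{\mathscr{C}}$ for which $\iota$ is exact. 3. With $\widetilde{\mathscr{C}}$ endowed with this structure, for every idempotent complete extriangulated category $\mathscr{D}$ restriction along $\iota$ is an equivalence of categories $$\mathrm{Hom}_{\mathrm{exact}}(\widetilde{\mathscr{C}},\mathscr{D})\xrightarrow{\;\sim\;}\mathrm{Hom}_{\mathrm{exact}}(\mathscr{C},\mathscr{D}),\qquad H\mapsto H\circ\iota,$$ where $\mathrm{Hom}_{\mathrm{exact}}$ denotes the category of exact functors and all natural transformations between them. -/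

import Mathlib

open CategoryTheory CategoryTheory.Limits Opposite

universe w v u w' v' u' w'' v'' u''

attribute [local instance] hasBinaryBiproducts_of_finite_biproducts

/-- A candidate extriangulated structure on an additive category: a bifunctor
`E : Cᵒᵖ × C ⥤ Ab`, written in curried form, and a correspondence `Realizes` between extensions
`δ ∈ E (C, A)` and sequences `A ⟶ B ⟶ C`. The set of sequences realizing `δ` plays the role of
the equivalence class `𝔰 δ`; that it is exactly one equivalence class is part of
`ExtriData.IsExtriangulated`. -/
structure ExtriData (𝒞 : Type u) [Category.{v} 𝒞] where
  /-- the bifunctor of extensions -/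
  E : 𝒞ᵒᵖ ⥤ 𝒞 ⥤ AddCommGrpCat.{w}
  /-- `Realizes x y δ` says that `𝔰 δ` is the class of the sequence `A --x--> B --y--> C` -/
  Realizes : ∀ {A B C : 𝒞}, (A ⟶ B) → (B ⟶ C) → ((E.obj (op C)).obj A) → Prop

namespace ExtriData

section Basic

variable {𝒞 : Type u} [Category.{v} 𝒞] (S : ExtriData.{w} 𝒞)

/-- The abelian group `E (C, A)` of extensions. -/
abbrev Ext (C A : 𝒞) : Type w := (S.E.obj (op C)).obj A

/-- The homomorphism `a_* : E (C, A) → E (C, A')` for `a : A ⟶ A'`. -/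
def push {C A A' : 𝒞} (a : A ⟶ A') : S.Ext C A →+ S.Ext C A' :=
  ((S.E.obj (op C)).map a).hom

/-- The homomorphism `c^* : E (C, A) → E (C', A)` for `c : C' ⟶ C`. -/
def pull {C C' A : 𝒞} (c : C' ⟶ C) : S.Ext C A →+ S.Ext C' A :=
  ((S.E.map c.op).app A).hom

theorem push_id {C A : 𝒞} (δ : S.Ext C A) : S.push (𝟙 A) δ = δ := by
  simp [push]

theorem push_comp {C A A' A'' : 𝒞} (a : A ⟶ A') (a' : A' ⟶ A'') (δ : S.Ext C A) :
    S.push (a ≫ a') δ = S.push a' (S.push a δ) := by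
  simp [push]

theorem pull_id {C A : 𝒞} (δ : S.Ext C A) : S.pull (𝟙 C) δ = δ := by
  simp [pull]

theorem pull_comp {C C' C'' A : 𝒞} (c' : C'' ⟶ C') (c : C' ⟶ C) (δ : S.Ext C A) :
    S.pull (c' ≫ c) δ = S.pull c' (S.pull c δ) := by
  simp [pull]

theorem pull_push {C C' A A' : 𝒞} (c : C' ⟶ C) (a : A ⟶ A') (δ : S.Ext C A) :
    S.pull c (S.push a δ) = S.push a (S.pull c δ) := by
  have h := (S.E.map c.op).naturality a
  exact DFunLike.congr_fun (congrArg AddCommGrpCat.Hom.hom h) δ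

/-- A sequence `A ⟶ B ⟶ C` is a conflation if it realizes some extension. -/
def IsConflation {A B C : 𝒞} (x : A ⟶ B) (y : B ⟶ C) : Prop :=
  ∃ δ : S.Ext C A, S.Realizes x y δ

/-- The direct sum `δ ⊕ δ'`, i.e. the element of `E (C ⊞ C', A ⊞ A')` with components
`(δ, 0, 0, δ')`. -/
noncomputable def extSum [Preadditive 𝒞] [HasFiniteBiproducts 𝒞] {A C A' C' : 𝒞}
    (δ : S.Ext C A) (δ' : S.Ext C' A') : S.Ext (C ⊞ C') (A ⊞ A') :=
  S.pull biprod.fst (S.push biprod.inl δ) + S.pull biprod.snd (S.push biprod.inr δ')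

/-- The axioms of an extriangulated category. -/
structure IsExtriangulated [Preadditive 𝒞] [HasFiniteBiproducts 𝒞] : Prop where
  /-- (ET1): `E` is additive in the covariant variable -/
  push_add : ∀ {C A A' : 𝒞} (a a' : A ⟶ A') (δ : S.Ext C A),
    S.push (a + a') δ = S.push a δ + S.push a' δ
  /-- (ET1): `E` is additive in the contravariant variable -/
  pull_add : ∀ {C C' A : 𝒞} (c c' : C' ⟶ C) (δ : S.Ext C A),
    S.pull (c + c') δ = S.pull c δ + S.pull c' δ
  /-- every extension is realized by a sequence -/
  exists_realizes : ∀ {A C : 𝒞} (δ : S.Ext C A),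
    ∃ (B : 𝒞) (x : A ⟶ B) (y : B ⟶ C), S.Realizes x y δ
  /-- sequences equivalent to one realizing `δ` realize `δ` -/
  realizes_of_iso : ∀ {A B B' C : 𝒞} {x : A ⟶ B} {y : B ⟶ C} {x' : A ⟶ B'} {y' : B' ⟶ C}
    {δ : S.Ext C A} (b : B ≅ B'), x ≫ b.hom = x' → b.hom ≫ y' = y →
    S.Realizes x y δ → S.Realizes x' y' δ
  /-- any two sequences realizing `δ` are equivalent -/
  iso_of_realizes : ∀ {A B B' C : 𝒞} {x : A ⟶ B} {y : B ⟶ C} {x' : A ⟶ B'} {y' : B' ⟶ C}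
    {δ : S.Ext C A}, S.Realizes x y δ → S.Realizes x' y' δ →
    ∃ b : B ≅ B', x ≫ b.hom = x' ∧ b.hom ≫ y' = y
  /-- (ET2): morphisms of extensions lift to the realizing sequences -/
  exists_lift : ∀ {A B C A' B' C' : 𝒞} {x : A ⟶ B} {y : B ⟶ C} {x' : A' ⟶ B'} {y' : B' ⟶ C'}
    {δ : S.Ext C A} {δ' : S.Ext C' A'} (a : A ⟶ A') (c : C ⟶ C'),
    S.Realizes x y δ → S.Realizes x' y' δ' → S.push a δ = S.pull c δ' →
    ∃ b : B ⟶ B', x ≫ b = a ≫ x' ∧ y ≫ c = b ≫ y'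
  /-- (ET2): the split extension is realized by the split sequence -/
  realizes_zero : ∀ A C : 𝒞,
    S.Realizes (biprod.inl : A ⟶ A ⊞ C) (biprod.snd : A ⊞ C ⟶ C) 0
  /-- (ET2): the realization is compatible with direct sums -/
  realizes_sum : ∀ {A B C A' B' C' : 𝒞} {x : A ⟶ B} {y : B ⟶ C} {x' : A' ⟶ B'} {y' : B' ⟶ C'}
    {δ : S.Ext C A} {δ' : S.Ext C' A'}, S.Realizes x y δ → S.Realizes x' y' δ' →
    S.Realizes (biprod.map x x') (biprod.map y y') (S.extSum δ δ')
  /-- (ET3) -/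
  et3 : ∀ {A B C A' B' C' : 𝒞} {x : A ⟶ B} {y : B ⟶ C} {x' : A' ⟶ B'} {y' : B' ⟶ C'}
    {δ : S.Ext C A} {δ' : S.Ext C' A'} (a : A ⟶ A') (b : B ⟶ B'),
    S.Realizes x y δ → S.Realizes x' y' δ' → x ≫ b = a ≫ x' →
    ∃ c : C ⟶ C', y ≫ c = b ≫ y' ∧ S.push a δ = S.pull c δ'
  /-- the dual of (ET3) -/
  et3_op : ∀ {A B C A' B' C' : 𝒞} {x : A ⟶ B} {y : B ⟶ C} {x' : A' ⟶ B'} {y' : B' ⟶ C'}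
    {δ : S.Ext C A} {δ' : S.Ext C' A'} (b : B ⟶ B') (c : C ⟶ C'),
    S.Realizes x y δ → S.Realizes x' y' δ' → y ≫ c = b ≫ y' →
    ∃ a : A ⟶ A', x ≫ b = a ≫ x' ∧ S.push a δ = S.pull c δ'
  /-- (ET4) -/
  et4 : ∀ {A B C D F : 𝒞} {f : A ⟶ B} {f' : B ⟶ D} {g : B ⟶ C} {g' : C ⟶ F}
    {δ : S.Ext D A} {δ' : S.Ext F B}, S.Realizes f f' δ → S.Realizes g g' δ' →
    ∃ (E : 𝒞) (h' : C ⟶ E) (d : D ⟶ E) (e : E ⟶ F) (δ'' : S.Ext E A),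
      S.Realizes (f ≫ g) h' δ'' ∧ f' ≫ d = g ≫ h' ∧ h' ≫ e = g' ∧
      S.Realizes d e (S.push f' δ') ∧ S.pull d δ'' = δ ∧ S.push f δ'' = S.pull e δ'
  /-- the dual of (ET4) -/
  et4_op : ∀ {A B C D F : 𝒞} {f' : D ⟶ A} {f : A ⟶ B} {g' : F ⟶ B} {g : B ⟶ C}
    {δ : S.Ext B D} {δ' : S.Ext C F}, S.Realizes f' f δ → S.Realizes g' g δ' →
    ∃ (E : 𝒞) (h' : E ⟶ A) (d : D ⟶ E) (e : E ⟶ F) (δ'' : S.Ext C E),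
      S.Realizes h' (f ≫ g) δ'' ∧ h' ≫ f = e ≫ g' ∧ d ≫ h' = f' ∧
      S.Realizes d e (S.pull g' δ) ∧ S.push e δ'' = δ' ∧ S.push d δ = S.pull g δ''

end Basic

section Functors

variable {𝒞 : Type u} [Category.{v} 𝒞] [Preadditive 𝒞] (S : ExtriData.{w} 𝒞)
  {𝒟 : Type u'} [Category.{v'} 𝒟] [Preadditive 𝒟] (T : ExtriData.{w'} 𝒟)
  {𝒟' : Type u''} [Category.{v''} 𝒟'] [Preadditive 𝒟'] (T' : ExtriData.{w''} 𝒟')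

/-- An additive functor is exact if it sends conflations to conflations. -/
structure IsExact (G : 𝒞 ⥤ 𝒟) : Prop where
  additive : G.Additive
  map_conflation : ∀ {A B C : 𝒞} (x : A ⟶ B) (y : B ⟶ C),
    S.IsConflation x y → T.IsConflation (G.map x) (G.map y)

theorem IsExact.comp {S : ExtriData.{w} 𝒞} {T : ExtriData.{w'} 𝒟} {T' : ExtriData.{w''} 𝒟'}
    {G : 𝒞 ⥤ 𝒟} {H : 𝒟 ⥤ 𝒟'} (hG : IsExact S T G) (hH : IsExact T T' H) :
    IsExact S T' (G ⋙ H) where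
  additive := by
    have := hG.additive
    have := hH.additive
    infer_instance
  map_conflation x y h := hH.map_conflation _ _ (hG.map_conflation x y h)

/-- The category of exact functors, with all natural transformations as morphisms. -/
abbrev ExactFunctors : Type _ :=
  ObjectProperty.FullSubcategory (fun G : 𝒞 ⥤ 𝒟 => IsExact S T G)

/-- Restriction `H ↦ G ⋙ H` of exact functors along an exact functor `G`. -/
def restrict {S : ExtriData.{w} 𝒞} {T : ExtriData.{w'} 𝒟} {G : 𝒞 ⥤ 𝒟} (hG : IsExact S T G) :
    ExactFunctors T T' ⥤ ExactFunctors S T' :=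
  ObjectProperty.lift _
    (ObjectProperty.ι _ ⋙ (Functor.whiskeringLeft 𝒞 𝒟 𝒟').obj G)
    (fun H => hG.comp H.property)

end Functors

section Completion

open CategoryTheory.Idempotents

variable {𝒞 : Type u} [Category.{v} 𝒞] (S : ExtriData.{w} 𝒞)

/-- For `C̃ = (C, f)` and `Ã = (A, e)` in the idempotent completion, the subgroup of those
`ω ∈ E (C, A)` with `f^* ω = ω = e_* ω`. -/
def karoubiExt (C A : Karoubi 𝒞) : AddSubgroup (S.Ext C.X A.X) where
  carrier := {ω | S.pull C.p ω = ω ∧ S.push A.p ω = ω}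
  zero_mem' := by simp
  add_mem' := by
    rintro a b ⟨h₁, h₂⟩ ⟨h₃, h₄⟩
    exact ⟨by rw [map_add, h₁, h₃], by rw [map_add, h₂, h₄]⟩
  neg_mem' := by
    rintro a ⟨h₁, h₂⟩
    exact ⟨by rw [map_neg, h₁], by rw [map_neg, h₂]⟩

/-- The map `ω ↦ α_* ω`. -/
def karoubiPush (C : Karoubi 𝒞) {A A' : Karoubi 𝒞} (α : A ⟶ A') :
    S.karoubiExt C A →+ S.karoubiExt C A' :=
  ((S.push α.f).comp (S.karoubiExt C A).subtype).codRestrict _ (fun ω => by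
    obtain ⟨ω, h₁, h₂⟩ := ω
    refine ⟨?_, ?_⟩
    · change S.pull C.p (S.push α.f ω) = S.push α.f ω
      rw [pull_push, h₁]
    · change S.push A'.p (S.push α.f ω) = S.push α.f ω
      rw [← push_comp, Karoubi.comp_p])

/-- The map `ω ↦ γ^* ω`. -/
def karoubiPull {C C' : Karoubi 𝒞} (γ : C' ⟶ C) (A : Karoubi 𝒞) :
    S.karoubiExt C A →+ S.karoubiExt C' A :=
  ((S.pull γ.f).comp (S.karoubiExt C A).subtype).codRestrict _ (fun ω => by
    obtain ⟨ω, h₁, h₂⟩ := ω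
    refine ⟨?_, ?_⟩
    · change S.pull C'.p (S.pull γ.f ω) = S.pull γ.f ω
      rw [← pull_comp, Karoubi.p_comp]
    · change S.push A.p (S.pull γ.f ω) = S.pull γ.f ω
      rw [← pull_push, h₂])

/-- The bifunctor `𝔽` on the idempotent completion. -/
def karoubiE : (Karoubi 𝒞)ᵒᵖ ⥤ Karoubi 𝒞 ⥤ AddCommGrpCat.{w} where
  obj C :=
    { obj := fun A => AddCommGrpCat.of (S.karoubiExt C.unop A)
      map := fun α => AddCommGrpCat.ofHom (S.karoubiPush C.unop α)
      map_id := fun A => by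
        ext ω
        exact ω.2.2
      map_comp := fun α β => by
        ext ω
        exact S.push_comp α.f β.f ω.1 }
  map γ :=
    { app := fun A => AddCommGrpCat.ofHom (S.karoubiPull γ.unop A)
      naturality := fun A A' α => by
        ext ω
        exact S.pull_push γ.unop.f α.f ω.1 }
  map_id C := by
    ext A ω
    exact ω.2.1
  map_comp γ γ' := by
    ext A ω
    exact (S.pull_comp γ'.unop.f γ.unop.f ω.1)

/-- The extriangulated structure on the idempotent completion. An extension
`ω ∈ 𝔽 (C̃, Ã) ⊆ E (C, A)` with `Ã = (A, e)`, `C̃ = (C, f)` is realized by the sequences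
equivalent to `Ã ⟶ (M, b) ⟶ C̃` with maps `α b` and `b β` (in diagrammatic order), where
`A --α--> M --β--> C` realizes `ω` in `𝒞` and `b` is an idempotent endomorphism of `M` such that
`(e, b, f)` is an endomorphism of this sequence. -/
def karoubi : ExtriData.{w} (Karoubi 𝒞) where
  E := S.karoubiE
  Realizes {A B C} x y ω :=
    ∃ (M : 𝒞) (α : A.X ⟶ M) (β : M ⟶ C.X) (b : M ⟶ M) (hb : b ≫ b = b)
      (φ : B ≅ Karoubi.mk M b hb),
      S.Realizes α β (show S.karoubiExt C A from ω).1 ∧ α ≫ b = A.p ≫ α ∧ b ≫ β = β ≫ C.p ∧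
      (x ≫ φ.hom).f = α ≫ b ∧ (φ.inv ≫ y).f = b ≫ β

end Completion

end ExtriData

/-! Everything rests on one nilpotence remark. In a conflation the deflation is a weak cokernel of
the inflation, so an endomorphism of the middle term that vanishes after the inflation and before
the deflation squares to zero. Hence an endomorphism inducing identities on both ends is invertible,
and one lifting idempotents `e`, `f` on the ends can be replaced by an idempotent lift
(`IsWeakCokernel.exists_idempotent_lift`). Since (ET2) lifts `(e, f)` whenever the extension is
fixed by both, every extension in the completion is realized, by a retract of a conflation of `𝒞`.

Conversely, a retract of a conflation realizes the corresponding retract of its extension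
(`HasRealizations.realizes_of_retract`). This yields direct sums in the completion. (ET3) and its
dual follow by cutting down the morphism found in `𝒞` with the idempotents.

(ET4) is the delicate axiom. The octahedron in `𝒞` produces an object `E` with an idempotent
compatible with the composite conflation, but possibly not with `D ⟶ E ⟶ F`. The idempotent is not
changed. Instead, corrected sections (`exists_octahedron_retraction`) exhibit the required sequence
as a retract of `D ⟶ E ⟶ F`.

Minimality and the universal property both come from `IsExact.of_toKaroubi_comp`: a functor on the
completion is exact once its restriction to `𝒞` is. Minimality is the case of the identity functor;
the equivalence adds only the universal property of the idempotent completion for plain functors. -/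

/-! ### Idempotents and isomorphisms from nilpotent perturbations -/

section Preadditive

variable {𝒞 : Type u} [Category.{v} 𝒞] [Preadditive 𝒞]

/-- Every map out of `B` killed by `x` factors through `y`. -/
def IsWeakCokernel {A B C : 𝒞} (x : A ⟶ B) (y : B ⟶ C) : Prop :=
  ∀ (X : 𝒞) (n : B ⟶ X), x ≫ n = 0 → ∃ k : C ⟶ X, n = y ≫ k

/-- The difference `θ - 𝟙` factors through `y` and is killed by `y` on the right, so it squares to
zero and `2 - θ` inverts `θ`. -/
theorem IsWeakCokernel.isIso_of_comp_eq {A B C : 𝒞} {x : A ⟶ B} {y : B ⟶ C}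
    (h : IsWeakCokernel x y) {θ : B ⟶ B} (hx : x ≫ θ = x) (hy : θ ≫ y = y) : IsIso θ := by
  obtain ⟨k, hk⟩ := h _ (θ - 𝟙 B) (by simp [hx])
  have h2 : (θ - 𝟙 B) ≫ (θ - 𝟙 B) = 0 := by
    nth_rw 2 [hk]
    rw [Preadditive.sub_comp, reassoc_of% hy, Category.id_comp, sub_self]
  have h3 : θ ≫ θ = θ + θ - 𝟙 B := by
    simp only [Preadditive.comp_sub, Preadditive.sub_comp, Category.id_comp,
      Category.comp_id] at h2
    rw [← sub_eq_zero, ← h2]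
    abel
  refine ⟨𝟙 B + 𝟙 B - θ, ?_, ?_⟩
  · simp only [Preadditive.comp_sub, Preadditive.comp_add, Category.comp_id, h3]
    abel
  · simp only [Preadditive.sub_comp, Preadditive.add_comp, Category.id_comp, h3]
    abel

/-- Both composites of `f` and `g` are invertible by the previous lemma, although `g` itself need
not be inverse to `f`. -/
theorem IsWeakCokernel.exists_iso {A B B' C : 𝒞} {x : A ⟶ B} {y : B ⟶ C} {x' : A ⟶ B'}
    {y' : B' ⟶ C} (h : IsWeakCokernel x y) (h' : IsWeakCokernel x' y') {f : B ⟶ B'} {g : B' ⟶ B}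
    (hxf : x ≫ f = x') (hfy : f ≫ y' = y) (hxg : x' ≫ g = x) (hgy : g ≫ y = y') :
    ∃ b : B ≅ B', b.hom = f := by
  have h₁ : IsIso (f ≫ g) := h.isIso_of_comp_eq (by rw [reassoc_of% hxf, hxg])
    (by rw [Category.assoc, hgy, hfy])
  have h₂ : IsIso (g ≫ f) := h'.isIso_of_comp_eq (by rw [reassoc_of% hxg, hxf])
    (by rw [Category.assoc, hfy, hgy])
  have h₃ : f ≫ (g ≫ inv (f ≫ g)) = 𝟙 B := by
    rw [← Category.assoc, IsIso.hom_inv_id]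
  have h₄ : (inv (g ≫ f) ≫ g) ≫ f = 𝟙 B' := by
    rw [Category.assoc, IsIso.inv_hom_id]
  have h₅ : inv (g ≫ f) ≫ g = g ≫ inv (f ≫ g) := by
    calc inv (g ≫ f) ≫ g = (inv (g ≫ f) ≫ g) ≫ f ≫ (g ≫ inv (f ≫ g)) := by
          rw [h₃, Category.comp_id]
      _ = _ := by rw [← Category.assoc, h₄, Category.id_comp]
  exact ⟨⟨f, g ≫ inv (f ≫ g), h₃, by rw [← h₅, h₄]⟩, rfl⟩

theorem IsWeakCokernel.of_retract {A B C A' B' C' : 𝒞} {x : A ⟶ B} {y : B ⟶ C} {x' : A' ⟶ B'}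
    {y' : B' ⟶ C'} (h : IsWeakCokernel x' y') {iB : B ⟶ B'} {pB : B' ⟶ B} {iC : C ⟶ C'}
    {pA : A' ⟶ A} (hB : iB ≫ pB = 𝟙 B) (hy : y ≫ iC = iB ≫ y') (hx : x' ≫ pB = pA ≫ x) :
    IsWeakCokernel x y := by
  intro X n hn
  obtain ⟨k, hk⟩ := h _ (pB ≫ n) (by rw [reassoc_of% hx, hn, comp_zero])
  exact ⟨iC ≫ k, by rw [reassoc_of% hy, ← hk, reassoc_of% hB]⟩

/-- The polynomial `3 q ^ 2 - 2 q ^ 3`, which is idempotent if `q ^ 2 - q` squares to zero. -/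
def idempotentLift {B : 𝒞} (q : B ⟶ B) : B ⟶ B :=
  q ≫ q + q ≫ q + q ≫ q - (q ≫ q ≫ q + q ≫ q ≫ q)

theorem idempotentLift_idem {B : 𝒞} (q : B ⟶ B) (h : (q ≫ q - q) ≫ (q ≫ q - q) = 0) :
    idempotentLift q ≫ idempotentLift q = idempotentLift q := by
  let r : End B := q
  have h' : (r * r - r) * (r * r - r) = 0 := h
  -- The hypothesis says `r⁴ = 2r³ - r²`; this and its multiples by `r` and `r²` bring the square of
  -- `3r² - 2r³` down to degree three.
  have h4 : r * r * r * r = r * r * r + r * r * r - r * r := by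
    rw [← sub_eq_zero, ← h']
    noncomm_ring
  have h5 : r * r * r * r * r = r * r * r * r + r * r * r * r - r * r * r := by
    have := congrArg (· * r) h4
    simpa only [add_mul, sub_mul] using this
  have h6 : r * r * r * r * r * r = r * r * r * r * r + r * r * r * r * r - r * r * r * r := by
    have := congrArg (· * r) h5
    simpa only [add_mul, sub_mul] using this
  change (r * r + r * r + r * r - (r * r * r + r * r * r)) *
    (r * r + r * r + r * r - (r * r * r + r * r * r)) =
      (r * r + r * r + r * r - (r * r * r + r * r * r))
  have e : (r * r + r * r + r * r - (r * r * r + r * r * r)) *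
    (r * r + r * r + r * r - (r * r * r + r * r * r)) =
      9 • (r * r * r * r) - 12 • (r * r * r * r * r) + 4 • (r * r * r * r * r * r) := by
    noncomm_ring
  rw [e, h6, h5, h4]
  noncomm_ring

/-- Every positive power of `q` restricts to `e` along `x`, and the coefficients of the polynomial
sum to `3 - 2 = 1`. -/
theorem comp_idempotentLift {A B : 𝒞} {x : A ⟶ B} {e : A ⟶ A} {q : B ⟶ B} (he : e ≫ e = e)
    (h : x ≫ q = e ≫ x) : x ≫ idempotentLift q = e ≫ x := by
  have h2 : x ≫ q ≫ q = e ≫ x := by rw [reassoc_of% h, h, reassoc_of% he]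
  have h3 : x ≫ q ≫ q ≫ q = e ≫ x := by rw [reassoc_of% h, h2, reassoc_of% he]
  simp only [idempotentLift, Preadditive.comp_sub, Preadditive.comp_add, h2, h3]
  abel

theorem idempotentLift_comp {B C : 𝒞} {y : B ⟶ C} {f : C ⟶ C} {q : B ⟶ B} (hf : f ≫ f = f)
    (h : q ≫ y = y ≫ f) : idempotentLift q ≫ y = y ≫ f := by
  have h2 : q ≫ q ≫ y = y ≫ f := by rw [h, reassoc_of% h, hf]
  have h3 : q ≫ q ≫ q ≫ y = y ≫ f := by rw [h2, reassoc_of% h, hf]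
  rw [idempotentLift]
  simp only [Preadditive.sub_comp, Preadditive.add_comp, Category.assoc]
  rw [h3, h2]
  abel

/-- The defect `q² - q` vanishes after `x`, hence factors through `y`, and vanishes before `y`; so
it squares to zero and the idempotent polynomial applies. -/
theorem IsWeakCokernel.exists_idempotent_lift {A B C : 𝒞} {x : A ⟶ B} {y : B ⟶ C}
    (h : IsWeakCokernel x y) {e : A ⟶ A} {f : C ⟶ C} {q : B ⟶ B} (he : e ≫ e = e)
    (hf : f ≫ f = f) (hx : x ≫ q = e ≫ x) (hy : q ≫ y = y ≫ f) :
    ∃ b : B ⟶ B, b ≫ b = b ∧ x ≫ b = e ≫ x ∧ b ≫ y = y ≫ f := by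
  refine ⟨idempotentLift q, idempotentLift_idem q ?_, comp_idempotentLift he hx,
    idempotentLift_comp hf hy⟩
  obtain ⟨k, hk⟩ := h _ (q ≫ q - q) (by
    rw [Preadditive.comp_sub, reassoc_of% hx, hx, reassoc_of% he, sub_self])
  nth_rw 2 [hk]
  have : (q ≫ q - q) ≫ y = 0 := by
    rw [Preadditive.sub_comp, Category.assoc, hy, reassoc_of% hy, hf, sub_self]
  rw [reassoc_of% this, zero_comp]

end Preadditive

namespace ExtriData

/-! ### Exactness properties of conflations -/

section Exactness

variable {𝒞 : Type u} [Category.{v} 𝒞] [Preadditive 𝒞] [HasFiniteBiproducts 𝒞]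
  {S : ExtriData.{w} 𝒞}

open scoped ZeroObject

namespace IsExtriangulated

theorem pull_zero (hS : S.IsExtriangulated) {C C' A : 𝒞} (δ : S.Ext C A) :
    S.pull (0 : C' ⟶ C) δ = 0 := by
  have h := hS.pull_add (0 : C' ⟶ C) 0 δ
  rwa [add_zero, left_eq_add] at h

theorem push_zero (hS : S.IsExtriangulated) {C A A' : 𝒞} (δ : S.Ext C A) :
    S.push (0 : A ⟶ A') δ = 0 := by
  have h := hS.push_add (0 : A ⟶ A') 0 δ
  rwa [add_zero, left_eq_add] at h

theorem pull_sub (hS : S.IsExtriangulated) {C C' A : 𝒞} (c c' : C' ⟶ C) (δ : S.Ext C A) :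
    S.pull (c - c') δ = S.pull c δ - S.pull c' δ := by
  rw [eq_sub_iff_add_eq, ← hS.pull_add, sub_add_cancel]

theorem push_sub (hS : S.IsExtriangulated) {C A A' : 𝒞} (a a' : A ⟶ A') (δ : S.Ext C A) :
    S.push (a - a') δ = S.push a δ - S.push a' δ := by
  rw [eq_sub_iff_add_eq, ← hS.push_add, sub_add_cancel]

variable {A B C : 𝒞} {x : A ⟶ B} {y : B ⟶ C} {δ : S.Ext C A}

/-- This and the following lemmas are fragments of the long exact sequences, each obtained by
comparing the given conflation with a split one having a zero end term. -/
theorem isWeakCokernel (hS : S.IsExtriangulated) (h : S.Realizes x y δ) :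
    IsWeakCokernel x y := by
  intro X n hn
  obtain ⟨c, hc, -⟩ := hS.et3 (0 : A ⟶ (0 : 𝒞)) (n ≫ (biprod.inr : X ⟶ (0 : 𝒞) ⊞ X)) h
    (hS.realizes_zero 0 X) (by rw [reassoc_of% hn, zero_comp, zero_comp])
  exact ⟨c, by simpa using hc.symm⟩

theorem exists_factor_inflation (hS : S.IsExtriangulated) (h : S.Realizes x y δ) {X : 𝒞}
    (n : X ⟶ B) (hn : n ≫ y = 0) : ∃ k : X ⟶ A, n = k ≫ x := by
  obtain ⟨a, ha, -⟩ := hS.et3_op ((biprod.fst : X ⊞ (0 : 𝒞) ⟶ X) ≫ n) (0 : (0 : 𝒞) ⟶ C)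
    (hS.realizes_zero X 0) h (by simp [hn])
  exact ⟨a, by simpa using ha⟩

theorem comp_eq_zero (hS : S.IsExtriangulated) (h : S.Realizes x y δ) : x ≫ y = 0 := by
  obtain ⟨b, hb, hb'⟩ := hS.exists_lift (𝟙 A) (0 : (0 : 𝒞) ⟶ C) (hS.realizes_zero A 0) h
    (by rw [map_zero, hS.pull_zero])
  have : x = biprod.inl ≫ b := by simpa using hb.symm
  rw [this, Category.assoc, ← hb', comp_zero, comp_zero]

theorem push_inflation (hS : S.IsExtriangulated) (h : S.Realizes x y δ) : S.push x δ = 0 := by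
  obtain ⟨c, -, hc⟩ := hS.et3 x (biprod.inl : B ⟶ B ⊞ (0 : 𝒞)) h (hS.realizes_zero B 0) rfl
  rw [hc, map_zero]

theorem pull_deflation (hS : S.IsExtriangulated) (h : S.Realizes x y δ) : S.pull y δ = 0 := by
  obtain ⟨c, -, hc⟩ := hS.et3_op (biprod.snd : (0 : 𝒞) ⊞ B ⟶ B) y (hS.realizes_zero 0 B) h rfl
  rw [← hc, map_zero]

theorem exists_factor_of_push_eq_zero (hS : S.IsExtriangulated) (h : S.Realizes x y δ) {X : 𝒞}
    {a : A ⟶ X} (ha : S.push a δ = 0) : ∃ k : B ⟶ X, a = x ≫ k := by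
  obtain ⟨b, hb, -⟩ := hS.exists_lift a (0 : C ⟶ (0 : 𝒞)) h (hS.realizes_zero X 0)
    (by rw [ha, map_zero])
  exact ⟨b ≫ biprod.fst, by rw [reassoc_of% hb, biprod.inl_fst, Category.comp_id]⟩

theorem exists_factor_of_pull_eq_zero (hS : S.IsExtriangulated) (h : S.Realizes x y δ) {X : 𝒞}
    {c : X ⟶ C} (hc : S.pull c δ = 0) : ∃ k : X ⟶ B, c = k ≫ y := by
  obtain ⟨b, -, hb⟩ := hS.exists_lift (0 : (0 : 𝒞) ⟶ A) c (hS.realizes_zero 0 X) h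
    (by rw [hc, map_zero])
  exact ⟨biprod.inr ≫ b, by rw [Category.assoc, ← hb, biprod.inr_snd_assoc]⟩

end IsExtriangulated

end Exactness

/-! ### Retracts of conflations -/

section Retract

variable {𝒞 : Type u} [Category.{v} 𝒞] [Preadditive 𝒞] {S : ExtriData.{w} 𝒞}

/-- The axioms of an extriangulated category needed to recognize retracts of conflations. -/
structure HasRealizations (S : ExtriData.{w} 𝒞) : Prop where
  exists_realizes : ∀ {A C : 𝒞} (δ : S.Ext C A),
    ∃ (B : 𝒞) (x : A ⟶ B) (y : B ⟶ C), S.Realizes x y δ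
  realizes_of_iso : ∀ {A B B' C : 𝒞} {x : A ⟶ B} {y : B ⟶ C} {x' : A ⟶ B'} {y' : B' ⟶ C}
    {δ : S.Ext C A} (b : B ≅ B'), x ≫ b.hom = x' → b.hom ≫ y' = y →
    S.Realizes x y δ → S.Realizes x' y' δ
  exists_lift : ∀ {A B C A' B' C' : 𝒞} {x : A ⟶ B} {y : B ⟶ C} {x' : A' ⟶ B'} {y' : B' ⟶ C'}
    {δ : S.Ext C A} {δ' : S.Ext C' A'} (a : A ⟶ A') (c : C ⟶ C'),
    S.Realizes x y δ → S.Realizes x' y' δ' → S.push a δ = S.pull c δ' →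
    ∃ b : B ⟶ B', x ≫ b = a ≫ x' ∧ y ≫ c = b ≫ y'
  isWeakCokernel : ∀ {A B C : 𝒞} {x : A ⟶ B} {y : B ⟶ C} {δ : S.Ext C A},
    S.Realizes x y δ → IsWeakCokernel x y

theorem IsExtriangulated.hasRealizations [HasFiniteBiproducts 𝒞] (hS : S.IsExtriangulated) :
    S.HasRealizations :=
  ⟨hS.exists_realizes, hS.realizes_of_iso, hS.exists_lift, hS.isWeakCokernel⟩

/-- A retract of a sequence realizing an extension realizes the corresponding retract of the
extension. -/
theorem HasRealizations.realizes_of_retract (hS : S.HasRealizations) {A B C A' B' C' : 𝒞}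
    {x : A ⟶ B} {y : B ⟶ C} {x' : A' ⟶ B'} {y' : B' ⟶ C'} {δ : S.Ext C A} {δ' : S.Ext C' A'}
    (h : S.Realizes x' y' δ') {iA : A ⟶ A'} {pA : A' ⟶ A} {iB : B ⟶ B'} {pB : B' ⟶ B}
    {iC : C ⟶ C'} {pC : C' ⟶ C} (hA : iA ≫ pA = 𝟙 A) (hB : iB ≫ pB = 𝟙 B) (hC : iC ≫ pC = 𝟙 C)
    (hxi : x ≫ iB = iA ≫ x') (hyi : y ≫ iC = iB ≫ y') (hxp : x' ≫ pB = pA ≫ x)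
    (hyp : y' ≫ pC = pB ≫ y) (hi : S.push iA δ = S.pull iC δ')
    (hp : S.push pA δ' = S.pull pC δ) : S.Realizes x y δ := by
  -- The retract is compared with an arbitrary realization of `δ`: lifting the inclusions and
  -- projections of the end terms gives maps both ways that are identities on the ends, so the two
  -- sequences are equivalent.
  obtain ⟨N, ξ, η, hN⟩ := hS.exists_realizes δ
  obtain ⟨s, hs, hs'⟩ := hS.exists_lift iA iC hN h hi
  obtain ⟨t, ht, ht'⟩ := hS.exists_lift pA pC h hN hp
  have hw : IsWeakCokernel x y := (hS.isWeakCokernel h).of_retract hB hyi hxp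
  have e₁ : ξ ≫ s ≫ pB = x := by rw [reassoc_of% hs, hxp, reassoc_of% hA]
  have e₂ : (s ≫ pB) ≫ y = η := by
    rw [Category.assoc, ← hyp, ← reassoc_of% hs', hC, Category.comp_id]
  have e₃ : x ≫ iB ≫ t = ξ := by rw [reassoc_of% hxi, ht, reassoc_of% hA]
  have e₄ : (iB ≫ t) ≫ η = y := by
    rw [Category.assoc, ← ht', ← reassoc_of% hyi, hC, Category.comp_id]
  obtain ⟨b, hb⟩ := (hS.isWeakCokernel hN).exists_iso hw e₁ e₂ e₃ e₄
  exact hS.realizes_of_iso b (by rw [hb, e₁]) (by rw [hb, e₂]) hN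

theorem HasRealizations.iso_of_realizes (hS : S.HasRealizations) {A B B' C : 𝒞} {x : A ⟶ B}
    {y : B ⟶ C} {x' : A ⟶ B'} {y' : B' ⟶ C} {δ : S.Ext C A} (h : S.Realizes x y δ)
    (h' : S.Realizes x' y' δ) : ∃ b : B ≅ B', x ≫ b.hom = x' ∧ b.hom ≫ y' = y := by
  obtain ⟨s, hs, hs'⟩ := hS.exists_lift (𝟙 A) (𝟙 C) h h' (by rw [push_id, pull_id])
  obtain ⟨t, ht, ht'⟩ := hS.exists_lift (𝟙 A) (𝟙 C) h' h (by rw [push_id, pull_id])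
  rw [Category.id_comp] at hs ht
  rw [Category.comp_id] at hs' ht'
  obtain ⟨b, hb⟩ := (hS.isWeakCokernel h).exists_iso (hS.isWeakCokernel h') hs hs'.symm ht ht'.symm
  exact ⟨b, by rw [hb, hs], by rw [hb, hs']⟩

end Retract

end ExtriData

namespace ExtriData

/-! ### The structure on the idempotent completion -/

section Karoubi

open CategoryTheory.Idempotents

variable {𝒞 : Type u} [Category.{v} 𝒞] {S : ExtriData.{w} 𝒞}

/-- The extension in `𝒞` underlying an extension in the idempotent completion. -/
def karoubiVal {C A : Karoubi 𝒞} : S.karoubi.Ext C A →+ S.Ext C.X A.X :=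
  (S.karoubiExt C A).subtype

/-- The extension in the idempotent completion given by an invariant extension in `𝒞`. -/
def karoubiMk {C A : Karoubi 𝒞} (ω : S.Ext C.X A.X) (h₁ : S.pull C.p ω = ω)
    (h₂ : S.push A.p ω = ω) : S.karoubi.Ext C A :=
  show S.karoubiExt C A from ⟨ω, h₁, h₂⟩

theorem karoubiVal_injective {C A : Karoubi 𝒞} {ω ω' : S.karoubi.Ext C A}
    (h : karoubiVal ω = karoubiVal ω') : ω = ω' :=
  Subtype.ext h

theorem karoubiVal_push {C A A' : Karoubi 𝒞} (a : A ⟶ A') (ω : S.karoubi.Ext C A) :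
    karoubiVal (S.karoubi.push a ω) = S.push a.f (karoubiVal ω) := rfl

theorem karoubiVal_pull {C C' A : Karoubi 𝒞} (c : C' ⟶ C) (ω : S.karoubi.Ext C A) :
    karoubiVal (S.karoubi.pull c ω) = S.pull c.f (karoubiVal ω) := rfl

theorem pull_p_karoubiVal {C A : Karoubi 𝒞} (ω : S.karoubi.Ext C A) :
    S.pull C.p (karoubiVal ω) = karoubiVal ω :=
  (show S.karoubiExt C A from ω).2.1

theorem push_p_karoubiVal {C A : Karoubi 𝒞} (ω : S.karoubi.Ext C A) :
    S.push A.p (karoubiVal ω) = karoubiVal ω :=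
  (show S.karoubiExt C A from ω).2.2

/-- The sequence `A ⟶ B ⟶ C` in the idempotent completion is the image of compatible idempotent
endomorphisms of the sequence `A.X ⟶ M ⟶ C.X` in `𝒞`. -/
structure Presents {A B C : Karoubi 𝒞} (x : A ⟶ B) (y : B ⟶ C) {M : 𝒞} (α : A.X ⟶ M)
    (β : M ⟶ C.X) (i : B.X ⟶ M) (p : M ⟶ B.X) : Prop where
  i_p : i ≫ p = B.p
  p_i : B.p ≫ i = i
  p_p : p ≫ B.p = p
  x_i : x.f ≫ i = A.p ≫ α
  i_β : i ≫ β = y.f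
  α_p : α ≫ p = x.f
  p_y : p ≫ y.f = β ≫ C.p

/-- The isomorphism `B ≅ (M, b)` amounts to a splitting `i`, `p` with `p ≫ i = b`, which puts all
the data in `𝒞`. -/
theorem karoubi_realizes_iff {A B C : Karoubi 𝒞} {x : A ⟶ B} {y : B ⟶ C}
    {ω : S.karoubi.Ext C A} : S.karoubi.Realizes x y ω ↔
      ∃ (M : 𝒞) (α : A.X ⟶ M) (β : M ⟶ C.X) (i : B.X ⟶ M) (p : M ⟶ B.X),
        S.Realizes α β (karoubiVal ω) ∧ Presents x y α β i p := by
  constructor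
  · rintro ⟨M, α, β, b, hb, φ, h, hα, hβ, hx, hy⟩
    have h₁ : φ.hom.f ≫ φ.inv.f = B.p := congrArg Karoubi.Hom.f φ.hom_inv_id
    have h₂ : φ.inv.f ≫ φ.hom.f = b := congrArg Karoubi.Hom.f φ.inv_hom_id
    have h₃ : b ≫ φ.inv.f = φ.inv.f := Karoubi.p_comp φ.inv
    have h₄ : φ.hom.f ≫ b = φ.hom.f := Karoubi.comp_p φ.hom
    rw [Karoubi.comp_f] at hx hy
    refine ⟨M, α, β, φ.hom.f, φ.inv.f, h, h₁, Karoubi.p_comp _, Karoubi.comp_p _,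
      by rw [hx, hα], ?_, ?_, by rw [hy, hβ]⟩
    · rw [← h₄, Category.assoc, ← hy, reassoc_of% h₁, Karoubi.p_comp]
    · rw [← h₃, ← Category.assoc, ← hx, Category.assoc, h₁, Karoubi.comp_p]
  · rintro ⟨M, α, β, i, p, h, hp⟩
    have hb : (p ≫ i) ≫ p ≫ i = p ≫ i := by
      rw [Category.assoc, reassoc_of% hp.i_p, hp.p_i]
    refine ⟨M, α, β, p ≫ i, hb,
      ⟨⟨i, by simp only [reassoc_of% hp.i_p, hp.p_i]⟩,
        ⟨p, by simp only [hp.p_p, Category.assoc, hp.i_p]⟩, ?_, ?_⟩, h, ?_, ?_, ?_, ?_⟩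
    · ext; exact hp.i_p
    · ext; rfl
    · rw [reassoc_of% hp.α_p, hp.x_i]
    · rw [Category.assoc, hp.i_β, hp.p_y]
    · change x.f ≫ i = α ≫ p ≫ i
      rw [reassoc_of% hp.α_p]
    · change p ≫ y.f = (p ≫ i) ≫ β
      rw [Category.assoc, hp.i_β]

theorem Presents.of_iso {A B B' C : Karoubi 𝒞} {x : A ⟶ B} {y : B ⟶ C} {x' : A ⟶ B'}
    {y' : B' ⟶ C} {M : 𝒞} {α : A.X ⟶ M} {β : M ⟶ C.X} {i : B.X ⟶ M} {p : M ⟶ B.X}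
    (h : Presents x y α β i p) (b : B ≅ B') (hx : x ≫ b.hom = x') (hy : b.hom ≫ y' = y) :
    Presents x' y' α β (b.inv.f ≫ i) (p ≫ b.hom.f) := by
  have h₁ : b.hom.f ≫ b.inv.f = B.p := congrArg Karoubi.Hom.f b.hom_inv_id
  have h₂ : b.inv.f ≫ b.hom.f = B'.p := congrArg Karoubi.Hom.f b.inv_hom_id
  subst hx hy
  refine ⟨?_, ?_, ?_, ?_, ?_, ?_, ?_⟩
  · rw [Category.assoc, reassoc_of% h.i_p, Karoubi.p_comp, h₂]
  · rw [Karoubi.p_comp_assoc]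
  · rw [Category.assoc, Karoubi.comp_p]
  · rw [Karoubi.comp_f, Category.assoc, reassoc_of% h₁, h.p_i, h.x_i]
  · rw [Category.assoc, h.i_β, Karoubi.comp_f, reassoc_of% h₂, Karoubi.p_comp]
  · rw [reassoc_of% h.α_p, Karoubi.comp_f]
  · rw [Category.assoc, ← Karoubi.comp_f, h.p_y]

/-- An extension in `𝒞`, viewed in the idempotent completion. -/
def karoubiExtOf {C A : 𝒞} (δ : S.Ext C A) :
    S.karoubi.Ext ((toKaroubi 𝒞).obj C) ((toKaroubi 𝒞).obj A) :=
  karoubiMk (C := (toKaroubi 𝒞).obj C) (A := (toKaroubi 𝒞).obj A) δ (S.pull_id δ) (S.push_id δ)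

theorem karoubi_realizes_toKaroubi {A B C : 𝒞} {x : A ⟶ B} {y : B ⟶ C} {δ : S.Ext C A}
    (h : S.Realizes x y δ) :
    S.karoubi.Realizes ((toKaroubi 𝒞).map x) ((toKaroubi 𝒞).map y) (karoubiExtOf δ) :=
  karoubi_realizes_iff.2 ⟨B, x, y, 𝟙 B, 𝟙 B, h, by simp, by simp, by simp, by simp, by simp,
    by simp, by simp⟩

/-- The inclusion of a presented sequence into its presentation. -/
def Presents.incl {A B C : Karoubi 𝒞} {x : A ⟶ B} {y : B ⟶ C} {M : 𝒞} {α : A.X ⟶ M}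
    {β : M ⟶ C.X} {i : B.X ⟶ M} {p : M ⟶ B.X} (h : Presents x y α β i p) :
    B ⟶ (toKaroubi 𝒞).obj M :=
  ⟨i, by simp [h.p_i]⟩

/-- The projection to a presented sequence from its presentation. -/
def Presents.proj {A B C : Karoubi 𝒞} {x : A ⟶ B} {y : B ⟶ C} {M : 𝒞} {α : A.X ⟶ M}
    {β : M ⟶ C.X} {i : B.X ⟶ M} {p : M ⟶ B.X} (h : Presents x y α β i p) :
    (toKaroubi 𝒞).obj M ⟶ B :=
  ⟨p, by simp [h.p_p]⟩

section

variable {A B C : Karoubi 𝒞} {x : A ⟶ B} {y : B ⟶ C} {M : 𝒞} {α : A.X ⟶ M}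
  {β : M ⟶ C.X} {i : B.X ⟶ M} {p : M ⟶ B.X}

theorem Presents.incl_proj (h : Presents x y α β i p) : h.incl ≫ h.proj = 𝟙 B := by ext; exact h.i_p

theorem Presents.x_incl (h : Presents x y α β i p) :
    x ≫ h.incl = A.retract.i ≫ (toKaroubi 𝒞).map α := by ext; exact h.x_i

theorem Presents.incl_β (h : Presents x y α β i p) :
    h.incl ≫ (toKaroubi 𝒞).map β = y ≫ C.retract.i := by
  ext
  exact h.i_β.trans (Karoubi.comp_p y).symm

theorem Presents.α_proj (h : Presents x y α β i p) :
    (toKaroubi 𝒞).map α ≫ h.proj = A.retract.r ≫ x := by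
  ext
  exact h.α_p.trans (Karoubi.p_comp x).symm

theorem Presents.proj_y (h : Presents x y α β i p) :
    h.proj ≫ y = (toKaroubi 𝒞).map β ≫ C.retract.r := by ext; exact h.p_y

end

/-- Both sides have underlying extension `ω`, by its invariance under the two idempotents. -/
theorem push_retract_i {C A : Karoubi 𝒞} (ω : S.karoubi.Ext C A) :
    S.karoubi.push A.retract.i ω = S.karoubi.pull C.retract.i (karoubiExtOf (karoubiVal ω)) :=
  karoubiVal_injective ((push_p_karoubiVal ω).trans (pull_p_karoubiVal ω).symm)

theorem push_retract_r {C A : Karoubi 𝒞} (ω : S.karoubi.Ext C A) :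
    S.karoubi.push A.retract.r (karoubiExtOf (karoubiVal ω)) = S.karoubi.pull C.retract.r ω :=
  karoubiVal_injective ((push_p_karoubiVal ω).trans (pull_p_karoubiVal ω).symm)

variable [Preadditive 𝒞]

theorem Presents.isWeakCokernel {A B C : Karoubi 𝒞} {x : A ⟶ B} {y : B ⟶ C} {M : 𝒞}
    {α : A.X ⟶ M} {β : M ⟶ C.X} {i : B.X ⟶ M} {p : M ⟶ B.X} (h : Presents x y α β i p)
    (hw : IsWeakCokernel α β) : IsWeakCokernel x y := by
  intro X n hn
  obtain ⟨k, hk⟩ := hw _ (p ≫ n.f) (by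
    rw [reassoc_of% h.α_p, ← Karoubi.comp_f, hn]; rfl)
  refine ⟨⟨C.p ≫ k ≫ X.p, by simp⟩, ?_⟩
  ext
  rw [Karoubi.comp_f, Karoubi.comp_p_assoc, ← h.i_β, Category.assoc, ← reassoc_of% hk,
    Karoubi.comp_p, reassoc_of% h.i_p, Karoubi.p_comp]

variable [HasFiniteBiproducts 𝒞]

/-- For existence, (ET2) lifts the two idempotents to the middle term and the lift is made
idempotent. Morphisms lift by working on presentations and composing with `i` and `p'`. -/
theorem IsExtriangulated.karoubi_hasRealizations (hS : S.IsExtriangulated) :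
    S.karoubi.HasRealizations where
  exists_realizes {A C} ω := by
    obtain ⟨M, α, β, h⟩ := hS.exists_realizes (karoubiVal ω)
    obtain ⟨b₀, hb₀, hb₀'⟩ := hS.exists_lift A.p C.p h h
      (by rw [push_p_karoubiVal, pull_p_karoubiVal])
    obtain ⟨b, hb, hα, hβ⟩ := (hS.isWeakCokernel h).exists_idempotent_lift A.idem C.idem hb₀
      hb₀'.symm
    refine ⟨⟨M, b, hb⟩, ⟨α ≫ b, ?_⟩, ⟨b ≫ β, ?_⟩,
      karoubi_realizes_iff.2 ⟨M, α, β, b, b, h, hb, hb, hb, ?_, rfl, rfl, ?_⟩⟩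
    · simp only [Category.assoc, A.idem_assoc, hα]
    · rw [Category.assoc, ← hβ, reassoc_of% hb, reassoc_of% hb]
    · rw [Category.assoc, hb, hα]
    · rw [reassoc_of% hb, hβ]
  realizes_of_iso b hx hy h := by
    obtain ⟨M, α, β, i, p, h, hp⟩ := karoubi_realizes_iff.1 h
    exact karoubi_realizes_iff.2 ⟨M, α, β, _, _, h, hp.of_iso b hx hy⟩
  exists_lift {A B C A' B' C' x y x' y' δ δ'} a c h h' hac := by
    obtain ⟨M, α, β, i, p, h, hp⟩ := karoubi_realizes_iff.1 h
    obtain ⟨M', α', β', i', p', h', hp'⟩ := karoubi_realizes_iff.1 h'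
    obtain ⟨b, hb, hb'⟩ := hS.exists_lift a.f c.f h h' (congrArg karoubiVal hac)
    refine ⟨⟨i ≫ b ≫ p', by simp only [Category.assoc, hp'.p_p, reassoc_of% hp.p_i]⟩, ?_, ?_⟩
    · ext
      simp only [Karoubi.comp_f, reassoc_of% hp.x_i, reassoc_of% hb, hp'.α_p,
        Karoubi.p_comp_assoc]
    · ext
      simp only [Karoubi.comp_f, Category.assoc, hp'.p_y, ← reassoc_of% hb', Karoubi.comp_p,
        reassoc_of% hp.i_β]
  isWeakCokernel h := by
    obtain ⟨M, α, β, i, p, h, hp⟩ := karoubi_realizes_iff.1 h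
    exact hp.isWeakCokernel (hS.isWeakCokernel h)

/-! ### (ET3) and its dual for the idempotent completion -/

section ET3

variable {A B C A' B' C' : Karoubi 𝒞} {x : A ⟶ B} {y : B ⟶ C} {x' : A' ⟶ B'} {y' : B' ⟶ C'}
  {δ : S.karoubi.Ext C A} {δ' : S.karoubi.Ext C' A'}

theorem IsExtriangulated.karoubi_et3 (hS : S.IsExtriangulated) (a : A ⟶ A') (b : B ⟶ B')
    (h : S.karoubi.Realizes x y δ) (h' : S.karoubi.Realizes x' y' δ') (hab : x ≫ b = a ≫ x') :
    ∃ c : C ⟶ C', y ≫ c = b ≫ y' ∧ S.karoubi.push a δ = S.karoubi.pull c δ' := by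
  obtain ⟨M, α, β, i, p, h, hp⟩ := karoubi_realizes_iff.1 h
  obtain ⟨M', α', β', i', p', h', hp'⟩ := karoubi_realizes_iff.1 h'
  have hab' : x.f ≫ b.f = a.f ≫ x'.f := congrArg Karoubi.Hom.f hab
  obtain ⟨c, hc, hc'⟩ := hS.et3 a.f (p ≫ b.f ≫ i') h h' (by
    rw [reassoc_of% hp.α_p, reassoc_of% hab', hp'.x_i, Karoubi.comp_p_assoc])
  refine ⟨⟨C.p ≫ c ≫ C'.p, by simp⟩, ?_, karoubiVal_injective ?_⟩
  · ext
    rw [Karoubi.comp_f, Karoubi.comp_p_assoc, ← hp.i_β, Category.assoc, reassoc_of% hc,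
      reassoc_of% hp.i_p, ← hp'.p_y, reassoc_of% hp'.i_p, Karoubi.p_comp, Karoubi.p_comp_assoc,
      Karoubi.comp_f]
  · rw [karoubiVal_push, karoubiVal_pull]
    change _ = S.pull (C.p ≫ c ≫ C'.p) _
    rw [pull_comp, pull_comp, pull_p_karoubiVal, ← hc', pull_push, pull_p_karoubiVal]

theorem IsExtriangulated.karoubi_et3_op (hS : S.IsExtriangulated) (b : B ⟶ B') (c : C ⟶ C')
    (h : S.karoubi.Realizes x y δ) (h' : S.karoubi.Realizes x' y' δ') (hbc : y ≫ c = b ≫ y') :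
    ∃ a : A ⟶ A', x ≫ b = a ≫ x' ∧ S.karoubi.push a δ = S.karoubi.pull c δ' := by
  obtain ⟨M, α, β, i, p, h, hp⟩ := karoubi_realizes_iff.1 h
  obtain ⟨M', α', β', i', p', h', hp'⟩ := karoubi_realizes_iff.1 h'
  have hbc' : y.f ≫ c.f = b.f ≫ y'.f := congrArg Karoubi.Hom.f hbc
  obtain ⟨a, ha, ha'⟩ := hS.et3_op (p ≫ b.f ≫ i') c.f h h' (by
    rw [Category.assoc, Category.assoc, hp'.i_β, ← hbc', reassoc_of% hp.p_y,
      Karoubi.p_comp])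
  refine ⟨⟨A.p ≫ a ≫ A'.p, by simp⟩, ?_, karoubiVal_injective ?_⟩
  · ext
    rw [Karoubi.comp_f, Karoubi.comp_f, Category.assoc, Category.assoc, Karoubi.p_comp,
      ← hp'.α_p, ← reassoc_of% ha, reassoc_of% hp.α_p, hp'.i_p, Karoubi.comp_p,
      Karoubi.p_comp_assoc]
  · rw [karoubiVal_push, karoubiVal_pull]
    change S.push (A.p ≫ a ≫ A'.p) _ = _
    rw [push_comp, push_comp, push_p_karoubiVal, ha', ← pull_push, push_p_karoubiVal]

end ET3

/-! ### Split and direct sum sequences -/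

section Biprod

variable {𝒟 : Type u'} [Category.{v'} 𝒟] [Preadditive 𝒟] [HasFiniteBiproducts 𝒟] (F : 𝒞 ⥤ 𝒟)

/-- The morphism from a direct sum to the image of a direct sum with components `j`, `j'`. -/
noncomputable def sumIncl {B B' : 𝒟} {M M' : 𝒞} (j : B ⟶ F.obj M) (j' : B' ⟶ F.obj M') :
    B ⊞ B' ⟶ F.obj (M ⊞ M') :=
  biprod.desc (j ≫ F.map biprod.inl) (j' ≫ F.map biprod.inr)

/-- The morphism from the image of a direct sum to a direct sum with components `r`, `r'`. -/
noncomputable def sumProj {B B' : 𝒟} {M M' : 𝒞} (r : F.obj M ⟶ B) (r' : F.obj M' ⟶ B') :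
    F.obj (M ⊞ M') ⟶ B ⊞ B' :=
  biprod.lift (F.map biprod.fst ≫ r) (F.map biprod.snd ≫ r')

section

variable {B B' : 𝒟} {M M' : 𝒞} (j : B ⟶ F.obj M) (j' : B' ⟶ F.obj M') (r : F.obj M ⟶ B)
  (r' : F.obj M' ⟶ B')

theorem inl_sumIncl : biprod.inl ≫ sumIncl F j j' = j ≫ F.map biprod.inl := biprod.inl_desc _ _

theorem inr_sumIncl : biprod.inr ≫ sumIncl F j j' = j' ≫ F.map biprod.inr := biprod.inr_desc _ _

theorem sumProj_fst : sumProj F r r' ≫ biprod.fst = F.map biprod.fst ≫ r := biprod.lift_fst _ _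

theorem sumProj_snd : sumProj F r r' ≫ biprod.snd = F.map biprod.snd ≫ r' := biprod.lift_snd _ _

theorem map_sumIncl {A A' : 𝒟} (x : A ⟶ B) (x' : A' ⟶ B') :
    biprod.map x x' ≫ sumIncl F j j' = sumIncl F (x ≫ j) (x' ≫ j') := by
  ext
  · rw [biprod.inl_map_assoc, inl_sumIncl, inl_sumIncl, Category.assoc]
  · rw [biprod.inr_map_assoc, inr_sumIncl, inr_sumIncl, Category.assoc]

theorem sumIncl_map {N N' : 𝒞} (f : M ⟶ N) (f' : M' ⟶ N') :
    sumIncl F j j' ≫ F.map (biprod.map f f') = sumIncl F (j ≫ F.map f) (j' ≫ F.map f') := by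
  ext
  · rw [reassoc_of% inl_sumIncl, inl_sumIncl, Category.assoc, ← F.map_comp, ← F.map_comp,
      biprod.inl_map]
  · rw [reassoc_of% inr_sumIncl, inr_sumIncl, Category.assoc, ← F.map_comp, ← F.map_comp,
      biprod.inr_map]

theorem sumProj_map {A A' : 𝒟} (x : B ⟶ A) (x' : B' ⟶ A') :
    sumProj F r r' ≫ biprod.map x x' = sumProj F (r ≫ x) (r' ≫ x') := by
  ext
  · rw [Category.assoc, biprod.map_fst, reassoc_of% sumProj_fst, sumProj_fst]
  · rw [Category.assoc, biprod.map_snd, reassoc_of% sumProj_snd, sumProj_snd]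

theorem map_sumProj {N N' : 𝒞} (f : N ⟶ M) (f' : N' ⟶ M') :
    F.map (biprod.map f f') ≫ sumProj F r r' = sumProj F (F.map f ≫ r) (F.map f' ≫ r') := by
  ext
  · rw [Category.assoc, sumProj_fst, sumProj_fst, ← F.map_comp_assoc, ← F.map_comp_assoc,
      biprod.map_fst]
  · rw [Category.assoc, sumProj_snd, sumProj_snd, ← F.map_comp_assoc, ← F.map_comp_assoc,
      biprod.map_snd]

variable [F.Additive]

theorem sumIncl_fst : sumIncl F j j' ≫ F.map biprod.fst = biprod.fst ≫ j := by
  ext <;> simp [sumIncl, ← F.map_comp]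

theorem sumIncl_snd : sumIncl F j j' ≫ F.map biprod.snd = biprod.snd ≫ j' := by
  ext <;> simp [sumIncl, ← F.map_comp]

theorem inl_sumProj : F.map biprod.inl ≫ sumProj F r r' = r ≫ biprod.inl := by
  ext <;> simp [sumProj, ← F.map_comp_assoc]

theorem inr_sumProj : F.map biprod.inr ≫ sumProj F r r' = r' ≫ biprod.inr := by
  ext <;> simp [sumProj, ← F.map_comp_assoc]

theorem sumIncl_sumProj (h : j ≫ r = 𝟙 B) (h' : j' ≫ r' = 𝟙 B') :
    sumIncl F j j' ≫ sumProj F r r' = 𝟙 (B ⊞ B') := by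
  ext
  · rw [Category.assoc, Category.assoc, sumProj_fst, reassoc_of% inl_sumIncl,
      ← F.map_comp_assoc, biprod.inl_fst, F.map_id, Category.id_comp, h, Category.comp_id,
      biprod.inl_fst]
  · rw [Category.assoc, Category.assoc, sumProj_snd, reassoc_of% inl_sumIncl,
      ← F.map_comp_assoc, biprod.inl_snd, F.map_zero, zero_comp, comp_zero, Category.comp_id,
      biprod.inl_snd]
  · rw [Category.assoc, Category.assoc, sumProj_fst, reassoc_of% inr_sumIncl,
      ← F.map_comp_assoc, biprod.inr_fst, F.map_zero, zero_comp, comp_zero, Category.comp_id,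
      biprod.inr_fst]
  · rw [Category.assoc, Category.assoc, sumProj_snd, reassoc_of% inr_sumIncl,
      ← F.map_comp_assoc, biprod.inr_snd, F.map_id, Category.id_comp, h', Category.comp_id,
      biprod.inr_snd]

end

end Biprod

theorem IsExtriangulated.karoubi_realizes_zero (hS : S.IsExtriangulated) (A C : Karoubi 𝒞) :
    S.karoubi.Realizes (biprod.inl : A ⟶ A ⊞ C) (biprod.snd : A ⊞ C ⟶ C) 0 := by
  have hA : A.retract.i ≫ A.retract.r = 𝟙 A := A.retract.retract
  have hC : C.retract.i ≫ C.retract.r = 𝟙 C := C.retract.retract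
  have h := hS.realizes_zero A.X C.X
  refine karoubi_realizes_iff.2 ⟨A.X ⊞ C.X, biprod.inl, biprod.snd,
    (sumIncl (toKaroubi 𝒞) A.retract.i C.retract.i).f,
    (sumProj (toKaroubi 𝒞) A.retract.r C.retract.r).f, ?_,
    congrArg Karoubi.Hom.f (sumIncl_sumProj (toKaroubi 𝒞) _ _ _ _ hA hC),
    Karoubi.p_comp _, Karoubi.comp_p _, congrArg Karoubi.Hom.f (inl_sumIncl (toKaroubi 𝒞) _ _),
    ?_, ?_, congrArg Karoubi.Hom.f (sumProj_snd (toKaroubi 𝒞) _ _)⟩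
  · rw [map_zero]
    exact h
  · refine (congrArg Karoubi.Hom.f (sumIncl_snd (toKaroubi 𝒞) _ _)).trans (Karoubi.comp_p _)
  · refine (congrArg Karoubi.Hom.f (inl_sumProj (toKaroubi 𝒞) _ _)).trans (Karoubi.p_comp _)

theorem karoubiExtOf_extSum {A C A' C' : 𝒞} (δ : S.Ext C A) (δ' : S.Ext C' A') :
    karoubiExtOf (S.extSum δ δ') =
      S.karoubi.pull ((toKaroubi 𝒞).map biprod.fst)
        (S.karoubi.push ((toKaroubi 𝒞).map biprod.inl) (karoubiExtOf δ)) +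
      S.karoubi.pull ((toKaroubi 𝒞).map biprod.snd)
        (S.karoubi.push ((toKaroubi 𝒞).map biprod.inr) (karoubiExtOf δ')) :=
  rfl

theorem IsExtriangulated.karoubi_realizes_sum (hS : S.IsExtriangulated)
    {A B C A' B' C' : Karoubi 𝒞} {x : A ⟶ B} {y : B ⟶ C} {x' : A' ⟶ B'} {y' : B' ⟶ C'}
    {δ : S.karoubi.Ext C A} {δ' : S.karoubi.Ext C' A'} (h : S.karoubi.Realizes x y δ)
    (h' : S.karoubi.Realizes x' y' δ') :
    S.karoubi.Realizes (biprod.map x x') (biprod.map y y') (S.karoubi.extSum δ δ') := by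
  obtain ⟨M, α, β, i, p, h, hp⟩ := karoubi_realizes_iff.1 h
  obtain ⟨M', α', β', i', p', h', hp'⟩ := karoubi_realizes_iff.1 h'
  -- The sum of two retracts is a retract of the image of the sum in `𝒞`. The chosen biproducts of
  -- the completion are not literally images of those of `𝒞`, which is why `sumIncl` and `sumProj`
  -- mediate.
  refine hS.karoubi_hasRealizations.realizes_of_retract
    (karoubi_realizes_toKaroubi (hS.realizes_sum h h'))
    (iA := sumIncl _ A.retract.i A'.retract.i) (pA := sumProj _ A.retract.r A'.retract.r)
    (iB := sumIncl _ hp.incl hp'.incl) (pB := sumProj _ hp.proj hp'.proj)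
    (iC := sumIncl _ C.retract.i C'.retract.i) (pC := sumProj _ C.retract.r C'.retract.r)
    (sumIncl_sumProj _ _ _ _ _ A.retract.retract A'.retract.retract)
    (sumIncl_sumProj _ _ _ _ _ hp.incl_proj hp'.incl_proj)
    (sumIncl_sumProj _ _ _ _ _ C.retract.retract C'.retract.retract) ?_ ?_ ?_ ?_ ?_ ?_
  · rw [map_sumIncl, sumIncl_map, hp.x_incl, hp'.x_incl]
  · rw [map_sumIncl, sumIncl_map, hp.incl_β, hp'.incl_β]
  · rw [sumProj_map, map_sumProj, hp.α_proj, hp'.α_proj]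
  · rw [sumProj_map, map_sumProj, hp.proj_y, hp'.proj_y]
  · rw [karoubiExtOf_extSum, extSum, map_add, map_add, ← pull_push, ← pull_push, ← push_comp,
      ← push_comp, inl_sumIncl, inr_sumIncl, push_comp, push_comp, push_retract_i, push_retract_i,
      ← pull_comp, ← pull_comp, sumIncl_fst, sumIncl_snd, pull_comp, pull_comp]
    simp only [pull_push]
  · rw [karoubiExtOf_extSum, extSum, map_add, map_add, ← pull_push, ← pull_push, ← push_comp,
      ← push_comp, inl_sumProj, inr_sumProj, push_comp, push_comp, push_retract_r, push_retract_r,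
      ← pull_comp, ← pull_comp, sumProj_fst, sumProj_snd, pull_comp, pull_comp]
    simp only [pull_push]

end Karoubi

end ExtriData

namespace ExtriData

open CategoryTheory.Idempotents

/-! ### Exact functors on the idempotent completion -/

section Exact

variable {𝒞 : Type u} [Category.{v} 𝒞] [Preadditive 𝒞] {S : ExtriData.{w} 𝒞}

theorem IsExact.of_iso {𝒟 : Type u'} [Category.{v'} 𝒟] [Preadditive 𝒟] {T : ExtriData.{w'} 𝒟}
    (hT : T.HasRealizations) {G G' : 𝒞 ⥤ 𝒟} (hG : IsExact S T G) (φ : G ≅ G') :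
    IsExact S T G' where
  additive := by
    have := hG.additive
    exact Functor.additive_of_iso φ
  map_conflation {A B C} x y h := by
    obtain ⟨δ, hδ⟩ := hG.map_conflation x y h
    refine ⟨T.push (φ.hom.app A) (T.pull (φ.inv.app C) δ),
      hT.realizes_of_retract hδ (iA := φ.inv.app A) (pA := φ.hom.app A) (iB := φ.inv.app B)
      (pB := φ.hom.app B) (iC := φ.inv.app C) (pC := φ.hom.app C) (φ.inv_hom_id_app A)
      (φ.inv_hom_id_app B) (φ.inv_hom_id_app C) (φ.inv.naturality x) (φ.inv.naturality y)
      (φ.hom.naturality x) (φ.hom.naturality y) ?_ ?_⟩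
    · rw [← push_comp, φ.hom_inv_id_app, push_id]
    · rw [pull_push, ← pull_comp, φ.hom_inv_id_app, pull_id]

variable (S) in
theorem isExact_toKaroubi : IsExact S S.karoubi (toKaroubi 𝒞) where
  additive := inferInstance
  map_conflation _ _ := fun ⟨δ, h⟩ => ⟨karoubiExtOf δ, karoubi_realizes_toKaroubi h⟩

variable [HasFiniteBiproducts 𝒞]

/-- Each conflation of the completion is a retract of the image of one in `𝒞`, and `H` preserves
retracts. The extension `δ` realized in `𝒟` is not given functorially, so its invariance under the
images of the idempotents has to be proved. -/
theorem IsExact.of_toKaroubi_comp {𝒟 : Type u'} [Category.{v'} 𝒟] [Preadditive 𝒟]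
    [HasFiniteBiproducts 𝒟] {T : ExtriData.{w'} 𝒟} (hS : S.IsExtriangulated)
    (hT : T.IsExtriangulated) {H : Karoubi 𝒞 ⥤ 𝒟} (hH : IsExact S T (toKaroubi 𝒞 ⋙ H)) :
    IsExact S.karoubi T H where
  additive := by
    have := hH.additive
    refine ⟨fun {P Q f g} => ?_⟩
    -- Each morphism is recovered from its underlying morphism in `𝒞`, so additivity is inherited
    -- from the restriction of `H`.
    have key (f : P ⟶ Q) : H.map f =
        H.map P.retract.i ≫ (toKaroubi 𝒞 ⋙ H).map f.f ≫ H.map Q.retract.r := by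
      rw [Functor.comp_map, ← H.map_comp, ← H.map_comp]
      congr 1
      ext
      change f.f = P.p ≫ f.f ≫ Q.p
      rw [f.comm]
    rw [key f, key g, key (f + g), ← Preadditive.comp_add, ← Preadditive.add_comp,
      ← Functor.map_add]
    rfl
  map_conflation {A B C} x y := by
    rintro ⟨ω, h⟩
    have := hH.additive
    obtain ⟨M, α, β, i, p, h, hp⟩ := karoubi_realizes_iff.1 h
    obtain ⟨δ, hδ⟩ := hH.map_conflation α β ⟨_, h⟩
    -- Since `𝟙 - A.p` kills the extension in `𝒞`, it factors through `α`; its image then factors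
    -- through the inflation of `δ`, which kills `δ`. The argument for `C` is dual.
    have hA : T.push ((toKaroubi 𝒞 ⋙ H).map A.p) δ = δ := by
      obtain ⟨k, hk⟩ := hS.exists_factor_of_push_eq_zero h (a := 𝟙 A.X - A.p)
        (by rw [hS.push_sub, push_id, push_p_karoubiVal, sub_self])
      have := congrArg (fun f => T.push ((toKaroubi 𝒞 ⋙ H).map f) δ) hk
      rw [Functor.map_sub, hT.push_sub, CategoryTheory.Functor.map_id, push_id,
        Functor.map_comp, push_comp, hT.push_inflation hδ, map_zero, sub_eq_zero] at this
      exact this.symm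
    have hC : T.pull ((toKaroubi 𝒞 ⋙ H).map C.p) δ = δ := by
      obtain ⟨k, hk⟩ := hS.exists_factor_of_pull_eq_zero h (c := 𝟙 C.X - C.p)
        (by rw [hS.pull_sub, pull_id, pull_p_karoubiVal, sub_self])
      have := congrArg (fun f => T.pull ((toKaroubi 𝒞 ⋙ H).map f) δ) hk
      rw [Functor.map_sub, hT.pull_sub, CategoryTheory.Functor.map_id, pull_id,
        Functor.map_comp, pull_comp, hT.pull_deflation hδ, map_zero, sub_eq_zero] at this
      exact this.symm
    have hr (P : Karoubi 𝒞) : H.map P.retract.r ≫ H.map P.retract.i =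
        (toKaroubi 𝒞 ⋙ H).map P.p := by
      rw [Functor.comp_map, ← H.map_comp]
      congr 1
      ext
      exact P.idem
    have hi (P : Karoubi 𝒞) : H.map P.retract.i ≫ H.map P.retract.r = 𝟙 (H.obj P) := by
      rw [← H.map_comp, P.retract.retract, H.map_id]
    refine ⟨T.push (H.map A.retract.r) (T.pull (H.map C.retract.i) δ),
      hT.hasRealizations.realizes_of_retract hδ (iA := H.map A.retract.i)
      (pA := H.map A.retract.r) (iB := H.map hp.incl) (pB := H.map hp.proj)
      (iC := H.map C.retract.i) (pC := H.map C.retract.r) (hi A) ?_ (hi C) ?_ ?_ ?_ ?_ ?_ ?_⟩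
    · rw [← H.map_comp, hp.incl_proj, H.map_id]
    · rw [← H.map_comp, hp.x_incl, H.map_comp]; rfl
    · rw [← H.map_comp, ← hp.incl_β, H.map_comp]; rfl
    · rw [← H.map_comp, ← hp.α_proj, H.map_comp]; rfl
    · rw [← H.map_comp, hp.proj_y, H.map_comp]; rfl
    · rw [← push_comp, hr, ← pull_push, hA]
    · rw [pull_push, ← pull_comp, hr, hC]

theorem IsExtriangulated.isConflation_of_isExact_toKaroubi (hS : S.IsExtriangulated)
    {T : ExtriData.{w'} (Karoubi 𝒞)} (hT : T.IsExtriangulated)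
    (h : IsExact S T (toKaroubi 𝒞)) {A B C : Karoubi 𝒞} (x : A ⟶ B) (y : B ⟶ C)
    (hxy : S.karoubi.IsConflation x y) : T.IsConflation x y :=
  (IsExact.of_toKaroubi_comp (H := 𝟭 _) hS hT h).map_conflation x y hxy

theorem IsExtriangulated.isEquivalence_restrict_toKaroubi (hS : S.IsExtriangulated)
    (hι : IsExact S S.karoubi (toKaroubi 𝒞)) {𝒟 : Type u'} [Category.{v'} 𝒟] [Preadditive 𝒟]
    [HasFiniteBiproducts 𝒟] [IsIdempotentComplete 𝒟] {T : ExtriData.{w'} 𝒟}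
    (hT : T.IsExtriangulated) : (restrict T hι).IsEquivalence := by
  let W := (Functor.whiskeringLeft 𝒞 (Karoubi 𝒞) 𝒟).obj (toKaroubi 𝒞)
  let P := ObjectProperty.ι (fun G : 𝒞 ⥤ 𝒟 => IsExact S T G)
  let Q := ObjectProperty.ι (fun G : Karoubi 𝒞 ⥤ 𝒟 => IsExact S.karoubi T G)
  -- Without exactness, restriction is an equivalence `W` because `𝒟` is idempotent complete. Exact
  -- functors form full subcategories, so only exactness of the extended functor remains.
  have e : restrict T hι ⋙ P ≅ Q ⋙ W := Iso.refl _
  have : (restrict T hι).Faithful := Functor.Faithful.of_comp_iso e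
  have : (restrict T hι).Full := Functor.Full.of_comp_faithful_iso e
  have : (restrict T hι).EssSurj := by
    refine ⟨fun G => ?_⟩
    let φ : W.obj (W.objPreimage G.obj) ≅ G.obj := W.objObjPreimageIso G.obj
    have hH : IsExact S T (toKaroubi 𝒞 ⋙ W.objPreimage G.obj) :=
      IsExact.of_iso hT.hasRealizations G.property φ.symm
    exact ⟨⟨W.objPreimage G.obj, hH.of_toKaroubi_comp hS hT⟩,
      ⟨ObjectProperty.isoMk _ φ⟩⟩
  exact { }

end Exact

end ExtriData

/-! ### Idempotents on octahedra -/

section Octahedron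

variable {𝒞 : Type u} [Category.{v} 𝒞] [Preadditive 𝒞]

/-- The idempotent `q` is compatible with `h` only. The first two conclusions make `(dp, q, fp)` a
projection from `D ⟶ E ⟶ F` onto the sequence with maps `d ≫ q`, `e ≫ fp`; `(v, u, fp)` is a section
of it. The last identity controls `v` on extensions pushed forward along `β`, up to a term through
`γ`. -/
theorem exists_octahedron_retraction {M N D E F : 𝒞} {β : M ⟶ D} {γ : M ⟶ N} {γ' : N ⟶ F}
    {h : N ⟶ E} {d : D ⟶ E} {e : E ⟶ F} {b : M ⟶ M} {n : N ⟶ N} {q : E ⟶ E} {dp : D ⟶ D}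
    {fp : F ⟶ F} (hn : n ≫ n = n) (hq : q ≫ q = q) (hdp : dp ≫ dp = dp)
    (hβd : β ≫ d = γ ≫ h) (he : h ≫ e = γ') (hde : d ≫ e = 0) (hbβ : b ≫ β = β ≫ dp)
    (hbγ : b ≫ γ = γ ≫ n) (hnγ : n ≫ γ' = γ' ≫ fp) (hhq : h ≫ q = n ≫ h) {t : D ⟶ M}
    (ht : t ≫ β = 𝟙 D - dp) (htb : t ≫ b = 0) {w : F ⟶ N} (hw : w ≫ γ' = 𝟙 F - fp)
    (hwn : w ≫ n = 0) {k : E ⟶ N} (hk : k ≫ h = 𝟙 E - q) (hkn : k ≫ n = 0)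
    (hγ : ∀ z : N ⟶ N, z ≫ γ' = 0 → ∃ l : N ⟶ M, z = l ≫ γ) :
    dp ≫ d ≫ q = d ≫ q ∧ q ≫ e ≫ fp = e ≫ fp ∧
      ∃ (u : E ⟶ E) (v : D ⟶ D) (s : N ⟶ D), u ≫ q = q ∧ q ≫ u = u ∧ v ≫ dp = dp ∧
        dp ≫ v = v ∧ u ≫ e = e ≫ fp ∧ v ≫ d = d ≫ q ≫ u ∧ β ≫ v = β ≫ dp - γ ≫ s := by
  have h₁ : dp ≫ d ≫ q = d ≫ q := by
    have : (t ≫ β) ≫ d ≫ q = 0 := by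
      rw [Category.assoc, reassoc_of% hβd, hhq, ← reassoc_of% hbγ, reassoc_of% htb, zero_comp]
    rw [ht, Preadditive.sub_comp, Category.id_comp, sub_eq_zero] at this
    exact this.symm
  have h₂ : q ≫ e ≫ fp = e ≫ fp := by
    have : (k ≫ h) ≫ e ≫ fp = 0 := by
      rw [Category.assoc, reassoc_of% he, ← hnγ, reassoc_of% hkn, zero_comp]
    rw [hk, Preadditive.sub_comp, Category.id_comp, sub_eq_zero] at this
    exact this.symm
  -- The map `𝟙 - γ' ≫ w` composed with `γ'` gives `γ' ≫ fp`, which `𝟙 - n` kills on the left.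
  obtain ⟨l, hl⟩ := hγ ((𝟙 N - n) ≫ (𝟙 N - γ' ≫ w)) (by
    simp only [Preadditive.sub_comp, Category.id_comp, Category.assoc,
      hw, Preadditive.comp_sub, Category.comp_id, reassoc_of% hnγ]
    rw [show γ' ≫ fp ≫ fp = n ≫ γ' by rw [← reassoc_of% hnγ, ← hnγ, reassoc_of% hn], hnγ]
    abel)
  have h₃ : k ≫ l ≫ γ = k - k ≫ γ' ≫ w := by
    rw [← hl]
    simp only [Preadditive.sub_comp, Category.id_comp, Category.comp_id, Preadditive.comp_sub,
      reassoc_of% hkn, zero_comp, hkn]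
    abel
  have h₄ : k ≫ l ≫ β ≫ (𝟙 D - dp) ≫ d = (𝟙 E - q) ≫ (𝟙 E - e ≫ w ≫ h) := by
    have : β ≫ (𝟙 D - dp) ≫ d = γ ≫ (𝟙 N - n) ≫ h := by
      simp only [Preadditive.sub_comp, Category.id_comp, Preadditive.comp_sub, hβd,
        ← reassoc_of% hbβ, ← reassoc_of% hbγ]
    rw [this]
    have h₅ : k ≫ l ≫ γ ≫ (𝟙 N - n) ≫ h = (k ≫ l ≫ γ) ≫ (𝟙 N - n) ≫ h := by
      simp only [Category.assoc]
    rw [h₅, h₃, ← hk]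
    simp only [Preadditive.sub_comp, Category.id_comp, Category.comp_id, Category.assoc,
      Preadditive.comp_sub, reassoc_of% hkn, zero_comp, reassoc_of% hwn, comp_zero, sub_zero,
      reassoc_of% he]
  -- In `u` the correction removes the part of `q ≫ e` lying in `𝟙 - fp`, since `w ≫ h ≫ e = 𝟙 -
  -- fp`. The correction of `v` is dictated by `h₄`, so that `v ≫ d = d ≫ q ≫ u`.
  refine ⟨h₁, h₂, q - q ≫ e ≫ w ≫ h, dp - dp ≫ d ≫ k ≫ l ≫ β ≫ (𝟙 D - dp),
    n ≫ h ≫ k ≫ l ≫ β ≫ (𝟙 D - dp), ?_, ?_, ?_, ?_, ?_, ?_, ?_⟩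
  · simp only [Preadditive.sub_comp, hq, Category.assoc, hhq, reassoc_of% hwn, zero_comp,
      comp_zero, sub_zero]
  · simp only [Preadditive.comp_sub, hq, reassoc_of% hq]
  · simp only [Preadditive.sub_comp, hdp, Category.assoc, Category.id_comp, sub_self, comp_zero,
      sub_zero]
  · simp only [Preadditive.comp_sub, hdp, reassoc_of% hdp]
  · rw [Preadditive.sub_comp, Category.assoc, Category.assoc, Category.assoc, he, hw,
      Preadditive.comp_sub, Preadditive.comp_sub, Category.comp_id, h₂]
    abel
  · have e₁ : (dp - dp ≫ d ≫ k ≫ l ≫ β ≫ (𝟙 D - dp)) ≫ d =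
        dp ≫ d - dp ≫ d ≫ k ≫ l ≫ β ≫ (𝟙 D - dp) ≫ d := by
      simp only [Preadditive.sub_comp, Category.assoc]
    rw [e₁, h₄]
    have e₂ : d ≫ q ≫ (q - q ≫ e ≫ w ≫ h) = dp ≫ d ≫ q - dp ≫ d ≫ q ≫ e ≫ w ≫ h := by
      rw [← reassoc_of% h₁, Preadditive.comp_sub, Preadditive.comp_sub, Preadditive.comp_sub, hq,
        reassoc_of% hq]
    rw [e₂]
    simp only [Preadditive.sub_comp, Category.id_comp, Category.comp_id,
      Preadditive.comp_sub, reassoc_of% hde, zero_comp, comp_zero]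
    abel
  · rw [Preadditive.comp_sub, ← reassoc_of% hbβ, reassoc_of% hβd, reassoc_of% hbγ]

/-- This is the preceding lemma in the opposite category; here the inclusion is given by the
idempotents and the projection is corrected. -/
theorem exists_octahedron_coretraction {M N D E F : 𝒞} {β : D ⟶ M} {γ : N ⟶ M} {γ' : F ⟶ N}
    {h : E ⟶ N} {d : E ⟶ D} {e : F ⟶ E} {b : M ⟶ M} {n : N ⟶ N} {q : E ⟶ E} {dp : D ⟶ D}
    {fp : F ⟶ F} (hn : n ≫ n = n) (hq : q ≫ q = q) (hdp : dp ≫ dp = dp)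
    (hβd : d ≫ β = h ≫ γ) (he : e ≫ h = γ') (hde : e ≫ d = 0) (hbβ : β ≫ b = dp ≫ β)
    (hbγ : γ ≫ b = n ≫ γ) (hnγ : γ' ≫ n = fp ≫ γ') (hhq : q ≫ h = h ≫ n) {t : M ⟶ D}
    (ht : β ≫ t = 𝟙 D - dp) (htb : b ≫ t = 0) {w : N ⟶ F} (hw : γ' ≫ w = 𝟙 F - fp)
    (hwn : n ≫ w = 0) {k : N ⟶ E} (hk : h ≫ k = 𝟙 E - q) (hkn : n ≫ k = 0)
    (hγ : ∀ z : N ⟶ N, γ' ≫ z = 0 → ∃ l : M ⟶ N, z = γ ≫ l) :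
    q ≫ d ≫ dp = q ≫ d ∧ fp ≫ e ≫ q = fp ≫ e ∧
      ∃ (u : E ⟶ E) (v : D ⟶ D) (s : D ⟶ N), q ≫ u = q ∧ u ≫ q = u ∧ dp ≫ v = dp ∧
        v ≫ dp = v ∧ e ≫ u = fp ≫ e ∧ d ≫ v = u ≫ q ≫ d ∧ v ≫ β = dp ≫ β - s ≫ γ := by
  obtain ⟨h₁, h₂, u, v, s, h₃, h₄, h₅, h₆, h₇, h₈, h₉⟩ := exists_octahedron_retraction
    (β := β.op) (γ := γ.op) (γ' := γ'.op) (h := h.op) (d := d.op) (e := e.op) (b := b.op)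
    (n := n.op) (q := q.op) (dp := dp.op) (fp := fp.op) (congrArg Quiver.Hom.op hn)
    (congrArg Quiver.Hom.op hq) (congrArg Quiver.Hom.op hdp) (congrArg Quiver.Hom.op hβd)
    (congrArg Quiver.Hom.op he) (congrArg Quiver.Hom.op hde) (congrArg Quiver.Hom.op hbβ)
    (congrArg Quiver.Hom.op hbγ) (congrArg Quiver.Hom.op hnγ) (congrArg Quiver.Hom.op hhq)
    (t := t.op) (congrArg Quiver.Hom.op ht) (congrArg Quiver.Hom.op htb)
    (w := w.op) (congrArg Quiver.Hom.op hw) (congrArg Quiver.Hom.op hwn)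
    (k := k.op) (congrArg Quiver.Hom.op hk) (congrArg Quiver.Hom.op hkn)
    (fun z hz => by
      obtain ⟨l, hl⟩ := hγ z.unop (congrArg Quiver.Hom.unop hz)
      exact ⟨l.op, congrArg Quiver.Hom.op hl⟩)
  have h₁ := congrArg Quiver.Hom.unop h₁
  have h₂ := congrArg Quiver.Hom.unop h₂
  have h₈ := congrArg Quiver.Hom.unop h₈
  simp only [unop_comp, Quiver.Hom.unop_op, Category.assoc] at h₁ h₂ h₈
  exact ⟨h₁, h₂, u.unop, v.unop, s.unop, congrArg Quiver.Hom.unop h₃, congrArg Quiver.Hom.unop h₄,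
    congrArg Quiver.Hom.unop h₅, congrArg Quiver.Hom.unop h₆, congrArg Quiver.Hom.unop h₇, h₈,
    congrArg Quiver.Hom.unop h₉⟩

end Octahedron

namespace ExtriData

/-! ### (ET4) for the idempotent completion -/

section ET4

open CategoryTheory.Idempotents

variable {𝒞 : Type u} [Category.{v} 𝒞] [Preadditive 𝒞] [HasFiniteBiproducts 𝒞]
  {S : ExtriData.{w} 𝒞}

theorem IsExtriangulated.exists_factor_inflation_idempotent (hS : S.IsExtriangulated)
    {A B C : 𝒞} {x : A ⟶ B} {y : B ⟶ C} {δ : S.Ext C A} (h : S.Realizes x y δ) {a : A ⟶ A}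
    {b : B ⟶ B} (ha : a ≫ a = a) (hb : b ≫ b = b) (hab : x ≫ b = a ≫ x)
    (hδ : S.push a δ = δ) : ∃ k : B ⟶ A, x ≫ k = 𝟙 A - a ∧ b ≫ k = 0 := by
  obtain ⟨k, hk⟩ := hS.exists_factor_of_push_eq_zero h (a := 𝟙 A - a)
    (by rw [hS.push_sub, push_id, hδ, sub_self])
  -- Composing with `𝟙 - b` forces the vanishing on the image of `b` and leaves the composite with
  -- `x` unchanged, as `𝟙 - a` is idempotent.
  refine ⟨(𝟙 B - b) ≫ k, ?_, ?_⟩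
  · rw [Preadditive.sub_comp, Category.id_comp, Preadditive.comp_sub, reassoc_of% hab, ← hk,
      Preadditive.comp_sub, ha, Category.comp_id, sub_self, sub_zero]
  · rw [Preadditive.sub_comp, Category.id_comp, Preadditive.comp_sub, reassoc_of% hb, sub_self]

theorem IsExtriangulated.exists_factor_deflation_idempotent (hS : S.IsExtriangulated)
    {A B C : 𝒞} {x : A ⟶ B} {y : B ⟶ C} {δ : S.Ext C A} (h : S.Realizes x y δ) {c : C ⟶ C}
    {b : B ⟶ B} (hc : c ≫ c = c) (hb : b ≫ b = b) (hbc : b ≫ y = y ≫ c)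
    (hδ : S.pull c δ = δ) : ∃ k : C ⟶ B, k ≫ y = 𝟙 C - c ∧ k ≫ b = 0 := by
  obtain ⟨k, hk⟩ := hS.exists_factor_of_pull_eq_zero h (c := 𝟙 C - c)
    (by rw [hS.pull_sub, pull_id, hδ, sub_self])
  refine ⟨k ≫ (𝟙 B - b), ?_, ?_⟩
  · rw [Category.assoc, Preadditive.sub_comp, Category.id_comp, hbc, Preadditive.comp_sub,
      ← reassoc_of% hk, ← hk, Preadditive.sub_comp, Category.id_comp, hc, sub_self, sub_zero]
  · rw [Category.assoc, Preadditive.sub_comp, Category.id_comp, hb, sub_self, comp_zero]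

theorem IsExtriangulated.pull_idempotentLift (hS : S.IsExtriangulated) {A C : 𝒞} {δ : S.Ext C A}
    {q : C ⟶ C} (h : S.pull q δ = δ) : S.pull (idempotentLift q) δ = δ := by
  simp only [idempotentLift, hS.pull_sub, hS.pull_add, pull_comp, h]
  abel

theorem IsExtriangulated.push_idempotentLift (hS : S.IsExtriangulated) {A C : 𝒞} {δ : S.Ext C A}
    {q : A ⟶ A} (h : S.push q δ = δ) : S.push (idempotentLift q) δ = δ := by
  simp only [idempotentLift, hS.push_sub, hS.push_add, push_comp, h]
  abel

/-- (ET3) gives `q` fixing `δ`. Then `q² - q` kills `δ`, so it factors through `y`, while `y ≫ (q² -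
q) = 0`; again the defect squares to zero. -/
theorem IsExtriangulated.exists_idempotent_cone (hS : S.IsExtriangulated) {A B C : 𝒞} {x : A ⟶ B}
    {y : B ⟶ C} {δ : S.Ext C A} (h : S.Realizes x y δ) {a : A ⟶ A} {b : B ⟶ B}
    (hb : b ≫ b = b) (hab : x ≫ b = a ≫ x) (hδ : S.push a δ = δ) :
    ∃ q : C ⟶ C, q ≫ q = q ∧ y ≫ q = b ≫ y ∧ S.pull q δ = δ := by
  obtain ⟨q, hq, hq'⟩ := hS.et3 a b h h hab
  rw [hδ] at hq'
  refine ⟨idempotentLift q, idempotentLift_idem q ?_, comp_idempotentLift hb hq,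
    hS.pull_idempotentLift hq'.symm⟩
  obtain ⟨k, hk⟩ := hS.exists_factor_of_pull_eq_zero h (c := q ≫ q - q)
    (by rw [hS.pull_sub, pull_comp, ← hq', ← hq', sub_self])
  have : y ≫ (q ≫ q - q) = 0 := by
    rw [Preadditive.comp_sub, reassoc_of% hq, hq, reassoc_of% hb, sub_self]
  nth_rw 1 [hk]
  rw [Category.assoc, this, comp_zero]

theorem IsExtriangulated.exists_idempotent_cocone (hS : S.IsExtriangulated) {A B C : 𝒞}
    {x : A ⟶ B} {y : B ⟶ C} {δ : S.Ext C A} (h : S.Realizes x y δ) {b : B ⟶ B} {c : C ⟶ C}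
    (hb : b ≫ b = b) (hbc : b ≫ y = y ≫ c) (hδ : S.pull c δ = δ) :
    ∃ q : A ⟶ A, q ≫ q = q ∧ q ≫ x = x ≫ b ∧ S.push q δ = δ := by
  obtain ⟨q, hq, hq'⟩ := hS.et3_op b c h h hbc.symm
  rw [hδ] at hq'
  refine ⟨idempotentLift q, idempotentLift_idem q ?_, idempotentLift_comp hb hq.symm,
    hS.push_idempotentLift hq'⟩
  obtain ⟨k, hk⟩ := hS.exists_factor_of_push_eq_zero h (a := q ≫ q - q)
    (by rw [hS.push_sub, push_comp, hq', hq', sub_self])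
  have : (q ≫ q - q) ≫ x = 0 := by
    rw [Preadditive.sub_comp, Category.assoc, ← hq, ← reassoc_of% hq, hb, sub_self]
  nth_rw 2 [hk]
  rw [reassoc_of% this, zero_comp]

/-- (ET4) in `𝒞` needs the second conflation to start at the middle term `M` presenting the first.
As `B ≅ (M, p ≫ i)`, the extension is moved to `(M, p ≫ i)`, realized there, and compared with the
given sequence by uniqueness. -/
theorem IsExtriangulated.exists_push_presentation (hS : S.IsExtriangulated) {B C F : Karoubi 𝒞}
    {g : B ⟶ C} {g' : C ⟶ F} {δ : S.karoubi.Ext F B} (h : S.karoubi.Realizes g g' δ) {M : 𝒞}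
    {i : B.X ⟶ M} {p : M ⟶ B.X} (hip : i ≫ p = B.p) (hi : B.p ≫ i = i) (hp : p ≫ B.p = p) :
    ∃ (N : 𝒞) (γ : M ⟶ N) (γ' : N ⟶ F.X) (j : C.X ⟶ N) (r : N ⟶ C.X),
      S.Realizes γ γ' (S.push i (karoubiVal δ)) ∧ j ≫ r = C.p ∧ C.p ≫ j = j ∧ r ≫ C.p = r ∧
      g.f ≫ j = i ≫ γ ∧ j ≫ γ' = g'.f ∧ γ ≫ r = p ≫ g.f ∧ r ≫ g'.f = γ' ≫ F.p := by
  let P : Karoubi 𝒞 := ⟨M, p ≫ i, by rw [Category.assoc, reassoc_of% hip, hi]⟩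
  let b : B ≅ P :=
    ⟨⟨i, by change _ ≫ _ ≫ _ ≫ _ = _; rw [reassoc_of% hip, hi, hi]⟩,
      ⟨p, by change (_ ≫ _) ≫ _ ≫ _ = _; rw [hp, Category.assoc, hip, hp]⟩,
      by ext; exact hip, by ext; rfl⟩
  obtain ⟨Q, x, y, hQ⟩ := hS.karoubi_hasRealizations.exists_realizes (S.karoubi.push b.hom δ)
  have hQ' : S.karoubi.Realizes (b.hom ≫ x) y δ :=
    hS.karoubi_hasRealizations.realizes_of_retract hQ (iA := b.hom) (pA := b.inv) (iB := 𝟙 _)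
      (pB := 𝟙 _) (iC := 𝟙 _) (pC := 𝟙 _) b.hom_inv_id (by simp) (by simp)
      (by rw [Category.comp_id]) (by rw [Category.comp_id, Category.id_comp])
      (by rw [Category.comp_id, b.inv_hom_id_assoc]) (by rw [Category.comp_id, Category.id_comp])
      (by rw [pull_id]) (by rw [← push_comp, b.hom_inv_id, push_id, pull_id])
  obtain ⟨φ, hφ, hφ'⟩ := hS.karoubi_hasRealizations.iso_of_realizes hQ' h
  obtain ⟨N, γ, γ', j, r, hN, hjr⟩ := karoubi_realizes_iff.1 hQ
  have hjr := hjr.of_iso φ rfl hφ'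
  have hg : i ≫ (x ≫ φ.hom).f = g.f := by
    rw [← hφ, Category.assoc]; rfl
  refine ⟨N, γ, γ', _, _, hN, hjr.i_p, hjr.p_i, hjr.p_p, ?_, hjr.i_β, ?_, hjr.p_y⟩
  · rw [← hg, Category.assoc, hjr.x_i]
    change i ≫ (p ≫ i) ≫ γ = _
    rw [Category.assoc, reassoc_of% hip, reassoc_of% hi]
  · rw [hjr.α_p, ← hg, ← Karoubi.p_comp (x ≫ φ.hom)]
    change (p ≫ i) ≫ _ = _ ≫ _ ≫ (p ≫ i) ≫ _
    simp only [Category.assoc, reassoc_of% hip, reassoc_of% hp]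

theorem IsExtriangulated.exists_pull_presentation (hS : S.IsExtriangulated) {D A B : Karoubi 𝒞}
    {f' : D ⟶ A} {f : A ⟶ B} {δ : S.karoubi.Ext B D} (h : S.karoubi.Realizes f' f δ) {M : 𝒞}
    {i : B.X ⟶ M} {p : M ⟶ B.X} (hip : i ≫ p = B.p) (hi : B.p ≫ i = i) (hp : p ≫ B.p = p) :
    ∃ (N : 𝒞) (γ : D.X ⟶ N) (γ' : N ⟶ M) (j : A.X ⟶ N) (r : N ⟶ A.X),
      S.Realizes γ γ' (S.pull p (karoubiVal δ)) ∧ j ≫ r = A.p ∧ A.p ≫ j = j ∧ r ≫ A.p = r ∧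
      f'.f ≫ j = D.p ≫ γ ∧ j ≫ γ' = f.f ≫ i ∧ γ ≫ r = f'.f ∧ r ≫ f.f = γ' ≫ p := by
  let P : Karoubi 𝒞 := ⟨M, p ≫ i, by rw [Category.assoc, reassoc_of% hip, hi]⟩
  let b : B ≅ P :=
    ⟨⟨i, by change _ ≫ _ ≫ _ ≫ _ = _; rw [reassoc_of% hip, hi, hi]⟩,
      ⟨p, by change (_ ≫ _) ≫ _ ≫ _ = _; rw [hp, Category.assoc, hip, hp]⟩,
      by ext; exact hip, by ext; rfl⟩
  obtain ⟨Q, x, y, hQ⟩ := hS.karoubi_hasRealizations.exists_realizes (S.karoubi.pull b.inv δ)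
  have hQ' : S.karoubi.Realizes x (y ≫ b.inv) δ :=
    hS.karoubi_hasRealizations.realizes_of_retract hQ (iA := 𝟙 _) (pA := 𝟙 _) (iB := 𝟙 _)
      (pB := 𝟙 _) (iC := b.hom) (pC := b.inv) (by simp) (by simp) b.hom_inv_id
      (by rw [Category.comp_id, Category.id_comp])
      (by rw [Category.assoc, b.inv_hom_id, Category.id_comp, Category.comp_id])
      (by rw [Category.comp_id, Category.id_comp]) (by rw [Category.id_comp])
      (by rw [← pull_comp, b.hom_inv_id, push_id, pull_id]) (by rw [push_id])
  obtain ⟨φ, hφ, hφ'⟩ := hS.karoubi_hasRealizations.iso_of_realizes hQ' h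
  obtain ⟨N, γ, γ', j, r, hN, hjr⟩ := karoubi_realizes_iff.1 hQ
  have hjr := hjr.of_iso φ hφ (φ.hom_inv_id_assoc y)
  have hf : (φ.inv ≫ y).f ≫ p = f.f := by
    rw [← (Iso.inv_comp_eq φ).2 hφ'.symm, ← Category.assoc]; rfl
  refine ⟨N, γ, γ', _, _, hN, hjr.i_p, hjr.p_i, hjr.p_p, hjr.x_i, ?_, hjr.α_p, ?_⟩
  · rw [hjr.i_β, ← hf, Category.assoc]
    exact (Karoubi.comp_p (φ.inv ≫ y)).symm
  · rw [← hf, ← Category.assoc, hjr.p_y]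
    change (γ' ≫ p ≫ i) ≫ p = _
    rw [Category.assoc, Category.assoc, hip, hp]

theorem IsExtriangulated.karoubi_et4 (hS : S.IsExtriangulated) {A B C D F : Karoubi 𝒞}
    {f : A ⟶ B} {f' : B ⟶ D} {g : B ⟶ C} {g' : C ⟶ F} {δ : S.karoubi.Ext D A}
    {δ' : S.karoubi.Ext F B} (hf : S.karoubi.Realizes f f' δ) (hg : S.karoubi.Realizes g g' δ') :
    ∃ (E : Karoubi 𝒞) (h' : C ⟶ E) (d : D ⟶ E) (e : E ⟶ F) (δ'' : S.karoubi.Ext E A),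
      S.karoubi.Realizes (f ≫ g) h' δ'' ∧ f' ≫ d = g ≫ h' ∧ h' ≫ e = g' ∧
      S.karoubi.Realizes d e (S.karoubi.push f' δ') ∧ S.karoubi.pull d δ'' = δ ∧
      S.karoubi.push f δ'' = S.karoubi.pull e δ' := by
  obtain ⟨M, α, β, i, p, hM, hp⟩ := karoubi_realizes_iff.1 hf
  obtain ⟨N, γ, γ', j, r, hN, hjr, hj, hr, hgj, hjγ, hγr, hrg⟩ :=
    hS.exists_push_presentation hg hp.i_p hp.p_i hp.p_p
  obtain ⟨E, h, d, e, ω, hω, hβd, he, hde, hdω, hαω⟩ := hS.et4 hM hN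
  have hb : (p ≫ i) ≫ p ≫ i = p ≫ i := by
    rw [Category.assoc, reassoc_of% hp.i_p, hp.p_i]
  have hn : (r ≫ j) ≫ r ≫ j = r ≫ j := by rw [Category.assoc, reassoc_of% hjr, hj]
  have hαb : α ≫ p ≫ i = A.p ≫ α := by rw [reassoc_of% hp.α_p, hp.x_i]
  have hbβ : (p ≫ i) ≫ β = β ≫ D.p := by rw [Category.assoc, hp.i_β, hp.p_y]
  have hbγ : (p ≫ i) ≫ γ = γ ≫ r ≫ j := by
    rw [Category.assoc, ← hgj, reassoc_of% hγr]
  have hnγ : (r ≫ j) ≫ γ' = γ' ≫ F.p := by rw [Category.assoc, hjγ, hrg]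
  -- Here `𝟙 - A.p = α ≫ s` with `i ≫ s = 0`, so `s` kills the pushed extension and factors through
  -- `γ`. Thus `𝟙 - A.p` factors through `α ≫ γ`, the inflation of `ω`.
  have hAω : S.push A.p ω = ω := by
    obtain ⟨s, hs, hs'⟩ := hS.exists_factor_inflation_idempotent hM A.idem hb hαb
      (push_p_karoubiVal δ)
    have hi : i ≫ s = 0 := by
      rw [← hp.p_i, ← hp.i_p, Category.assoc, Category.assoc, ← Category.assoc p, hs', comp_zero]
    obtain ⟨k, hk⟩ := hS.exists_factor_of_push_eq_zero hN (a := s)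
      (by rw [← push_comp, hi, hS.push_zero])
    have := hS.push_sub (𝟙 A.X) A.p ω
    rw [← hs, hk, ← Category.assoc, push_comp, hS.push_inflation hω, map_zero, push_id] at this
    exact (sub_eq_zero.1 this.symm).symm
  obtain ⟨q, hq, hhq, hqω⟩ := hS.exists_idempotent_cone hω (a := A.p) hn
    (by rw [Category.assoc, ← hbγ, Category.assoc, reassoc_of% hp.α_p,
      reassoc_of% hp.x_i]) hAω
  obtain ⟨t, ht, htb⟩ := hS.exists_factor_deflation_idempotent hM D.idem hb hbβ
    (pull_p_karoubiVal δ)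
  obtain ⟨w, hw, hwn⟩ := hS.exists_factor_deflation_idempotent hN F.idem hn hnγ
    (by rw [pull_push, pull_p_karoubiVal])
  obtain ⟨k, hk, hkn⟩ := hS.exists_factor_deflation_idempotent hω hq hn hhq.symm hqω
  obtain ⟨h₁, h₂, u, v, s, huq, hqu, hvD, hDv, hue, hvd, hβv⟩ :=
    exists_octahedron_retraction hn hq D.idem hβd he (hS.comp_eq_zero hde) hbβ hbγ hnγ hhq ht htb
      hw hwn hk hkn (fun z hz => hS.exists_factor_inflation hN z hz)
  have hjh : j ≫ h ≫ q = j ≫ h := by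
    rw [hhq, Category.assoc, reassoc_of% hjr, reassoc_of% hj]
  refine ⟨⟨E, q, hq⟩, ⟨j ≫ h, ?_⟩, ⟨d ≫ q, ?_⟩, ⟨e ≫ F.p, ?_⟩, karoubiMk ω hqω hAω,
    karoubi_realizes_iff.2 ⟨N, α ≫ γ, h, j, r, hω, hjr, hj, hr, ?_, rfl, ?_, ?_⟩, ?_, ?_, ?_,
    ?_, ?_⟩
  · rw [Category.assoc, hjh, reassoc_of% hj]
  · simp only [Category.assoc, hq, h₁]
  · simp only [Category.assoc, F.idem, h₂]
  · rw [Karoubi.comp_f, Category.assoc, hgj, reassoc_of% hp.x_i]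
  · rw [Category.assoc, hγr, reassoc_of% hp.α_p, Karoubi.comp_f]
  · change r ≫ j ≫ h = h ≫ q
    rw [hhq, Category.assoc]
  · ext
    change f'.f ≫ d ≫ q = g.f ≫ j ≫ h
    rw [← hjh, reassoc_of% hgj, ← hp.i_β, Category.assoc, reassoc_of% hβd]
  · ext
    change (j ≫ h) ≫ e ≫ F.p = g'.f
    rw [Category.assoc, reassoc_of% he, reassoc_of% hjγ, Karoubi.comp_p]
  -- The third conflation is a retract of the image of `D.X ⟶ E ⟶ F.X`, with corrected inclusions
  -- `v`, `u` and the idempotents as projections.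
  · refine hS.karoubi_hasRealizations.realizes_of_retract (karoubi_realizes_toKaroubi hde)
      (iA := ⟨v, ?_⟩) (pA := D.retract.r) (iB := ⟨u, ?_⟩) (pB := ⟨q, ?_⟩) (iC := F.retract.i)
      (pC := F.retract.r) ?_ ?_ F.retract.retract ?_ ?_ ?_ ?_ ?_ ?_
    · simp [hDv]
    · simp [hqu]
    · simp [hq]
    · ext; exact hvD
    · ext; exact huq
    · ext
      exact (Category.assoc _ _ _).trans hvd.symm
    · ext
      change (e ≫ F.p) ≫ F.p = u ≫ e
      rw [Category.assoc, F.idem, hue]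
    · ext
      exact h₁.symm
    · ext
      exact h₂.symm
    -- The error term `γ ≫ s` in `β ≫ v` disappears because the inflation `γ` kills the extension it
    -- realizes.
    · apply karoubiVal_injective
      change S.push v (S.push f'.f (karoubiVal δ')) =
        S.pull F.p (S.push β (S.push i (karoubiVal δ')))
      rw [pull_push, pull_push, pull_p_karoubiVal, ← hp.i_β, push_comp, ← S.push_comp β, hβv,
        hS.push_sub, S.push_comp γ, hS.push_inflation hN, map_zero, sub_zero, ← push_comp,
        ← Category.assoc, hp.i_β, Karoubi.comp_p, ← hp.i_β, push_comp]
    · apply karoubiVal_injective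
      change S.push D.p (S.push β (S.push i (karoubiVal δ'))) =
        S.pull F.p (S.push f'.f (karoubiVal δ'))
      rw [pull_push, pull_p_karoubiVal, ← S.push_comp i, hp.i_β, ← push_comp, Karoubi.comp_p]
  · apply karoubiVal_injective
    change S.pull (d ≫ q) ω = _
    rw [pull_comp, hqω, hdω]
  · apply karoubiVal_injective
    change S.push f.f ω = S.pull (e ≫ F.p) (karoubiVal δ')
    rw [pull_comp, pull_p_karoubiVal, ← hp.α_p, push_comp, hαω, ← pull_push, ← push_comp, hp.i_p,
      push_p_karoubiVal]

theorem IsExtriangulated.karoubi_et4_op (hS : S.IsExtriangulated) {A B C D F : Karoubi 𝒞}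
    {f' : D ⟶ A} {f : A ⟶ B} {g' : F ⟶ B} {g : B ⟶ C} {δ : S.karoubi.Ext B D}
    {δ' : S.karoubi.Ext C F} (hf : S.karoubi.Realizes f' f δ) (hg : S.karoubi.Realizes g' g δ') :
    ∃ (E : Karoubi 𝒞) (h' : E ⟶ A) (d : D ⟶ E) (e : E ⟶ F) (δ'' : S.karoubi.Ext C E),
      S.karoubi.Realizes h' (f ≫ g) δ'' ∧ h' ≫ f = e ≫ g' ∧ d ≫ h' = f' ∧
      S.karoubi.Realizes d e (S.karoubi.pull g' δ) ∧ S.karoubi.push e δ'' = δ' ∧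
      S.karoubi.push d δ = S.karoubi.pull g δ'' := by
  obtain ⟨M, α, β, i, p, hM, hp⟩ := karoubi_realizes_iff.1 hg
  obtain ⟨N, γ, γ', j, r, hN, hjr, hj, hr, hfj, hjγ, hγr, hrf⟩ :=
    hS.exists_pull_presentation hf hp.i_p hp.p_i hp.p_p
  obtain ⟨E, h, d, e, ω, hω, hβd, he, hde, hdω, hαω⟩ := hS.et4_op hN hM
  have hb : (p ≫ i) ≫ p ≫ i = p ≫ i := by
    rw [Category.assoc, reassoc_of% hp.i_p, hp.p_i]
  have hn : (r ≫ j) ≫ r ≫ j = r ≫ j := by rw [Category.assoc, reassoc_of% hjr, hj]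
  have hαb : α ≫ p ≫ i = F.p ≫ α := by rw [reassoc_of% hp.α_p, hp.x_i]
  have hbβ : (p ≫ i) ≫ β = β ≫ C.p := by rw [Category.assoc, hp.i_β, hp.p_y]
  have hbγ : γ' ≫ p ≫ i = (r ≫ j) ≫ γ' := by
    rw [Category.assoc, hjγ, reassoc_of% hrf]
  have hnγ : γ ≫ r ≫ j = D.p ≫ γ := by rw [reassoc_of% hγr, hfj]
  -- Dually to (ET4), `𝟙 - C.p` factors through `γ' ≫ β`, the deflation of `ω`.
  have hCω : S.pull C.p ω = ω := by
    obtain ⟨s, hs, hs'⟩ := hS.exists_factor_deflation_idempotent hM C.idem hb hbβ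
      (pull_p_karoubiVal δ')
    have hsp : s ≫ p = 0 := by
      rw [← hp.p_p, ← hp.i_p, ← Category.assoc, ← Category.assoc, Category.assoc s, hs', zero_comp]
    obtain ⟨k, hk⟩ := hS.exists_factor_of_pull_eq_zero hN (c := s)
      (by rw [← pull_comp, hsp, hS.pull_zero])
    have := hS.pull_sub (𝟙 C.X) C.p ω
    rw [← hs, hk, Category.assoc, pull_comp, hS.pull_deflation hω, map_zero, pull_id] at this
    exact (sub_eq_zero.1 this.symm).symm
  obtain ⟨q, hq, hhq, hqω⟩ := hS.exists_idempotent_cocone hω (c := C.p) hn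
    (by rw [Category.assoc r, ← reassoc_of% hbγ, hp.i_β, hp.p_y, Category.assoc]) hCω
  obtain ⟨t, ht, htb⟩ := hS.exists_factor_inflation_idempotent hM F.idem hb hαb
    (push_p_karoubiVal δ')
  obtain ⟨w, hw, hwn⟩ := hS.exists_factor_inflation_idempotent hN D.idem hn hnγ
    (by rw [← pull_push, push_p_karoubiVal])
  obtain ⟨k, hk, hkn⟩ := hS.exists_factor_inflation_idempotent hω hq hn hhq.symm hqω
  obtain ⟨h₁, h₂, u, v, s, hqu, huq, hFv, hvF, hdu, hev, hvα⟩ :=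
    exists_octahedron_coretraction hn hq F.idem hβd.symm he (hS.comp_eq_zero hde) hαb hbγ hnγ hhq
      ht htb hw hwn hk hkn (fun z hz => hS.isWeakCokernel hN _ z hz)
  have hhr : q ≫ h ≫ r = h ≫ r := by
    rw [reassoc_of% hhq, hjr, hr]
  refine ⟨⟨E, q, hq⟩, ⟨h ≫ r, ?_⟩, ⟨D.p ≫ d, ?_⟩, ⟨q ≫ e, ?_⟩, karoubiMk ω hCω hqω,
    karoubi_realizes_iff.2 ⟨N, h, γ' ≫ β, j, r, hω, hjr, hj, hr, ?_, ?_, rfl, ?_⟩, ?_, ?_, ?_,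
    ?_, ?_⟩
  · rw [Category.assoc, hr, hhr]
  · simp only [Category.assoc, h₂, D.idem_assoc]
  · simp only [Category.assoc, reassoc_of% hq, h₁]
  · change (h ≫ r) ≫ j = q ≫ h
    rw [hhq, Category.assoc]
  · rw [reassoc_of% hjγ, hp.i_β, Karoubi.comp_f]
  · rw [Karoubi.comp_f, reassoc_of% hrf, hp.p_y, Category.assoc]
  · ext
    change (h ≫ r) ≫ f.f = (q ≫ e) ≫ g'.f
    rw [← hp.α_p, Category.assoc, Category.assoc, hrf, ← reassoc_of% hβd, reassoc_of% hhq,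
      reassoc_of% hjγ, hp.i_p, Karoubi.comp_p, hrf]
  · ext
    change (D.p ≫ d) ≫ h ≫ r = f'.f
    rw [Category.assoc, reassoc_of% he, hγr, Karoubi.p_comp]
  · refine hS.karoubi_hasRealizations.realizes_of_retract (karoubi_realizes_toKaroubi hde)
      (iA := D.retract.i) (pA := D.retract.r) (iB := ⟨q, ?_⟩) (pB := ⟨u, ?_⟩)
      (iC := F.retract.i) (pC := ⟨v, ?_⟩) D.retract.retract ?_ ?_ ?_ ?_ ?_ ?_ ?_ ?_
    · simp [hq]
    · simp [huq]
    · simp [hvF]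
    · ext; exact hqu
    · ext; exact hFv
    · ext
      exact (Category.assoc _ _ _).trans h₂
    · ext
      exact (Category.assoc _ _ _).trans h₁
    · ext
      change d ≫ u = D.p ≫ D.p ≫ d
      rw [D.idem_assoc, hdu]
    · ext
      exact hev
    · apply karoubiVal_injective
      change S.push D.p (S.pull g'.f (karoubiVal δ)) =
        S.pull F.p (S.pull α (S.pull p (karoubiVal δ)))
      rw [← pull_push, push_p_karoubiVal, ← S.pull_comp α, hp.α_p, ← pull_comp, Karoubi.p_comp]
    · apply karoubiVal_injective
      change S.push D.p (S.pull α (S.pull p (karoubiVal δ))) =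
        S.pull v (S.pull g'.f (karoubiVal δ))
      rw [← pull_push, ← pull_push, push_p_karoubiVal, ← hp.α_p, S.pull_comp α, ← S.pull_comp v, hvα,
        hS.pull_sub, S.pull_comp s, hS.pull_deflation hN, map_zero, sub_zero, ← pull_comp,
        ← pull_comp, Category.assoc, hp.α_p, Karoubi.p_comp]
  · apply karoubiVal_injective
    change S.push (q ≫ e) ω = _
    rw [push_comp, hqω, hdω]
  · apply karoubiVal_injective
    change S.push (D.p ≫ d) (karoubiVal δ) = S.pull g.f ω
    rw [push_comp, push_p_karoubiVal, ← hp.i_β, pull_comp, ← hαω, pull_push, ← pull_comp, hp.i_p,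
      pull_p_karoubiVal]

end ET4

/-! ### Assembly of the axioms and the main theorem -/

theorem IsExtriangulated.karoubi {𝒞 : Type u} [Category.{v} 𝒞] [Preadditive 𝒞]
    [HasFiniteBiproducts 𝒞] {S : ExtriData.{w} 𝒞} (hS : S.IsExtriangulated) :
    S.karoubi.IsExtriangulated where
  push_add a a' δ := karoubiVal_injective (hS.push_add a.f a'.f (karoubiVal δ))
  pull_add c c' δ := karoubiVal_injective (hS.pull_add c.f c'.f (karoubiVal δ))
  exists_realizes := hS.karoubi_hasRealizations.exists_realizes
  realizes_of_iso := hS.karoubi_hasRealizations.realizes_of_iso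
  iso_of_realizes := hS.karoubi_hasRealizations.iso_of_realizes
  exists_lift := hS.karoubi_hasRealizations.exists_lift
  realizes_zero := hS.karoubi_realizes_zero
  realizes_sum := hS.karoubi_realizes_sum
  et3 := hS.karoubi_et3
  et3_op := hS.karoubi_et3_op
  et4 := hS.karoubi_et4
  et4_op := hS.karoubi_et4_op

end ExtriData

theorem mainTheorem3
    {𝒞 : Type u} [Category.{v} 𝒞] [Preadditive 𝒞] [HasFiniteBiproducts 𝒞]
    (S : ExtriData.{w} 𝒞) (hS : S.IsExtriangulated) :
    S.karoubi.IsExtriangulated ∧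
    ∃ hι : ExtriData.IsExact S S.karoubi (Idempotents.toKaroubi 𝒞),
      (∀ T : ExtriData.{w'} (Idempotents.Karoubi 𝒞), T.IsExtriangulated →
        ExtriData.IsExact S T (Idempotents.toKaroubi 𝒞) →
        ∀ {A B C : Idempotents.Karoubi 𝒞} (x : A ⟶ B) (y : B ⟶ C),
          S.karoubi.IsConflation x y → T.IsConflation x y) ∧
      (∀ (𝒟 : Type u'') [Category.{v''} 𝒟] [Preadditive 𝒟] [HasFiniteBiproducts 𝒟]
        [IsIdempotentComplete 𝒟] (T : ExtriData.{w''} 𝒟), T.IsExtriangulated →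
        (ExtriData.restrict T hι).IsEquivalence) :=
  ⟨hS.karoubi, ExtriData.isExact_toKaroubi S,
    fun _ hT h _ _ _ x y hxy => hS.isConflation_of_isExact_toKaroubi hT h x y hxy,
    fun _ _ _ _ _ _ hT => hS.isEquivalence_restrict_toKaroubi _ hT⟩
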